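/- Let $\mathfrak g$ be a finite-dimensional real Lie algebra with an ad-invariant inner product $\langle\cdot,\cdot\rangle$ (equivalently, the Lie algebra of a compact connected Lie group with an invariant inner product). Let $\mathfrak l\subset\mathfrak k\subset\mathfrak g$ be subalgebras such that $(\mathfrak g,\mathfrak k)$ is a symmetric pair, i.e. with $\mathfrak w=\mathfrak k^\perp$ one has $[\mathfrak w,\mathfrak w]\subset\mathfrak k$ and $[\mathfrak k,\mathfrak w]\subset\mathfrak w$. Let $\mathfrak w=\mathfrak w_0\oplus\mathfrak w_1\oplus\dots\oplus\mathfrak w_m$ be an orthogonal decomposition, where $\mathfrak w_0=\{x\in\mathfrak w: [\mathfrak l,x]=0\}$ and $\mathfrak w_1,\dots,\mathfrak w_m$ are irreducible for the adjoint action of $\mathfrak l$. Let $\mathfrak d\subset\mathfrak g$ be a subspace of the form $$\mathfrak d=\mathfrak u+\mathfrak d_0+\mathfrak d_1+\dots+\mathfrak d_g,\qquad \mathfrak u=\mathfrak d\cap\mathfrak l,\quad \mathfrak d_k=\mathfrak d\cap\mathfrak w_k,\qquad g\le m,$$ with $\dim\mathfrak u\ge 1$ and $\mathfrak d_k\ne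 0$ for $k=1,\dots,g$. Let $\mathcal A:\mathfrak g\to\mathfrak g$ be a symmetric positive definite operator which preserves $\mathfrak u,\mathfrak d_0,\dots,\mathfrak d_g$, with $\mathcal A|_{\mathfrak u}=s\cdot\mathrm{Id}$, $s\in\mathbb R$. The Euler--Poincaré--Suslov (EPS) equations are $$\dot x=[x,\mathcal A x]_{\mathfrak d},\qquad x\in\mathfrak d,$$ where the subscript denotes orthogonal projection to $\mathfrak d$. Let $x_k$ be the orthogonal projection of $x$ to $\mathfrak d_k$ and, for $k=1,\dots,g$, put $B_k=\mathcal A|_{\mathfrak d_k}-s\cdot\mathrm{Id}$, $F_k(x)=\langle B_kx_k,x_k\rangle$; let $F(x)=\langle x,x\rangle$. For $c_0\in\mathfrak d_0$ and $c_1,\dots,c_{g+1}\in\mathbb R$ let $$M_c=\{x\in\mathfrak d: x_0=c_0,\ F_1(x)=c_1,\dots,F_g(x)=c_g,\ F(x)=c_{g+1}\}.$$ **Theorem.** The sets $M_c$ are invariant under the EPS equations. Assume moreover that $B_1,\dots,B_g$ are positive definite, that $c_k>0$ for $k=1,\dots,g$, and that $$c_{g+1}>|c_0|^2+\sum_{k=1}^g\frac{c_k}{b_k},\qquad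 b_k=\min_{\xi\in\mathfrak d_k,\ |\xi|=1}\langle B_k\xi,\xi\rangle .$$ 1. $M_c$ is diffeomorphic to the product of spheres $S^{\dim\mathfrak d_1-1}\times\dots\times S^{\dim\mathfrak d_g-1}\times S^{\dim\mathfrak u-1}$. 2. If $\dim\mathfrak u=1$ and $\dim\mathfrak d_k=2$ for $k=1,\dots,g$, then $M_c$ is the disjoint union of two $g$-dimensional tori, each with angular coordinates $\varphi=(\varphi_1,\dots,\varphi_g)$ modulo $2\pi$ in which the EPS equations take the form $\dot\varphi_i=\Omega_i/\Phi(\varphi)$, $i=1,\dots,g$, where the $\Omega_i$ are real constants, the same on both tori, and $\Phi$ is a smooth positive function, $2\pi$-periodic in each variable. More generally, if $\dim\mathfrak u=1$ and $\dim\mathfrak d_k\le2$ for all $k=1,\dots,g$, the same holds with $2^{1+p}$ tori of dimension $r$, with angles $\varphi_1,\dots,\varphi_r$, where $p$ and $r=g-p$ are the numbers of $k$ with $\dim\mathfrak d_k=1$ and $\dim\mathfrak d_k=2$ respectively. -/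

import Mathlib

open scoped ContDiff

/-- An additive group carrying both a norm and a Lie bracket. -/
class NormedLieRing (L : Type*) extends NormedAddCommGroup L, LieRing L

/-- A real Lie algebra with an ad-invariant inner product. In finite dimension these are exactly
the Lie algebras of compact connected Lie groups, with the restriction of a bi-invariant metric. -/
class InvariantInnerLieAlgebra (L : Type*) [NormedLieRing L]
    extends InnerProductSpace ℝ L, LieAlgebra ℝ L where
  inner_lie : ∀ x y z : L, Inner.inner ℝ ⁅x, y⁆ z = Inner.inner ℝ x ⁅y, z⁆

section Smooth

variable {E F : Type*} [NormedAddCommGroup E] [NormedSpace ℝ E]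
  [NormedAddCommGroup F] [NormedSpace ℝ F]

/-- Smoothness of a map on an arbitrary subset `X` of a normed space: near each point of `X` it is
the restriction of a smooth map defined on an open set of the ambient space. -/
def SmoothOnSubset (f : E → F) (X : Set E) : Prop :=
  ∀ x ∈ X, ∃ U : Set E, IsOpen U ∧ x ∈ U ∧
    ∃ h : E → F, ContDiffOn ℝ ∞ h U ∧ Set.EqOn f h (U ∩ X)

/-- `f` restricts to a diffeomorphism of the subset `X` onto the subset `Y`, with inverse `f'`. -/
structure IsDiffeoOn (f : E → F) (f' : F → E) (X : Set E) (Y : Set F) : Prop where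
  mapsTo : Set.MapsTo f X Y
  mapsTo_inv : Set.MapsTo f' Y X
  invOn : Set.InvOn f' f X Y
  smooth : SmoothOnSubset f X
  smooth_inv : SmoothOnSubset f' Y

/-- The subsets `X` and `Y` of normed spaces are diffeomorphic. -/
def DiffeomorphicSets (X : Set E) (Y : Set F) : Prop :=
  ∃ (f : E → F) (f' : F → E), IsDiffeoOn f f' X Y

end Smooth

/-- The product `S^{n₁-1} × ⋯ × S^{n_g-1} × S^{n-1}` of unit spheres
in `ℝ^{n₁} × ⋯ × ℝ^{n_g} × ℝ^n`. -/
def sphereProduct {g : ℕ} (n : Fin g → ℕ) (n' : ℕ) :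
    Set ((∀ k, EuclideanSpace ℝ (Fin (n k))) × EuclideanSpace ℝ (Fin n')) :=
  {p | (∀ k, ‖p.1 k‖ = 1) ∧ ‖p.2‖ = 1}

/-- The standard `r`-dimensional torus in `ℂ^r`. -/
def stdTorus (r : ℕ) : Set (Fin r → ℂ) := {z | ∀ i, ‖z i‖ = 1}

/-- The point of the standard torus with angular coordinates `φ₁, …, φ_r`. -/
noncomputable def torusPoint {r : ℕ} (φ : Fin r → ℝ) : Fin r → ℂ :=
  fun i => Complex.exp ((φ i : ℂ) * Complex.I)

/-- `(𝔤, 𝔨)` is a symmetric pair: with `𝔴 = 𝔨ᗮ`, one has `[𝔨, 𝔨] ⊆ 𝔨` (as `𝔨` is a subalgebra),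
`[𝔴, 𝔴] ⊆ 𝔨` and `[𝔨, 𝔴] ⊆ 𝔴`. -/
structure IsSymmetricPair {𝔤 : Type*} [NormedLieRing 𝔤] [InvariantInnerLieAlgebra 𝔤]
    (𝔨 : LieSubalgebra ℝ 𝔤) : Prop where
  lie_perp_perp : ∀ x ∈ 𝔨.toSubmoduleᗮ, ∀ y ∈ 𝔨.toSubmoduleᗮ, ⁅x, y⁆ ∈ 𝔨
  lie_perp : ∀ x ∈ 𝔨, ∀ y ∈ 𝔨.toSubmoduleᗮ, ⁅x, y⁆ ∈ 𝔨.toSubmoduleᗮ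

/-- The data of Euler–Poincaré–Suslov equations on a symmetric pair: a chain of subalgebras
`𝔩 ⊆ 𝔨 ⊆ 𝔤` with `(𝔤, 𝔨)` a symmetric pair, the decomposition of `𝔴 = 𝔨ᗮ` under `𝔩`, the constraint
subspace `𝔡` adapted to it, and the compatible operator `A` (the inverse inertia operator). -/
structure EPSData (𝔤 : Type*) [NormedLieRing 𝔤] [InvariantInnerLieAlgebra 𝔤] where
  𝔨 : LieSubalgebra ℝ 𝔤
  𝔩 : LieSubalgebra ℝ 𝔤
  𝔩_le_𝔨 : 𝔩 ≤ 𝔨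
  symmetricPair : IsSymmetricPair 𝔨
  /-- the number of nontrivial irreducible summands of `𝔴` -/
  m : ℕ
  /-- the subspace of `𝔴` on which `𝔩` acts trivially -/
  w₀ : Submodule ℝ 𝔤
  mem_w₀ : ∀ x, x ∈ w₀ ↔ x ∈ 𝔨.toSubmoduleᗮ ∧ ∀ η ∈ 𝔩, ⁅η, x⁆ = 0
  /-- the irreducible summands `𝔴₁, …, 𝔴_m` for the adjoint action of `𝔩` -/
  w : Fin m → LieSubmodule ℝ 𝔩 𝔤
  w_irreducible : ∀ j, LieModule.IsIrreducible ℝ 𝔩 (w j)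
  w₀_orthogonal : ∀ j, w₀ ⟂ (w j).toSubmodule
  w_orthogonal : ∀ i j, i ≠ j → (w i).toSubmodule ⟂ (w j).toSubmodule
  w_sum : w₀ ⊔ ⨆ j, (w j).toSubmodule = 𝔨.toSubmoduleᗮ
  /-- the constraint subspace; its orthogonal complement `𝔥` is spanned by the covectors `a^i` -/
  𝔡 : Submodule ℝ 𝔤
  /-- the number of summands `𝔴₁, …, 𝔴_g` met by `𝔡` -/
  g : ℕ
  g_le_m : g ≤ m
  𝔡_sum : 𝔡 = (𝔡 ⊓ 𝔩.toSubmodule) ⊔ (𝔡 ⊓ w₀) ⊔ ⨆ k : Fin g, 𝔡 ⊓ (w (Fin.castLE g_le_m k)).toSubmodule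
  𝔡_inf_w_ne_bot : ∀ k : Fin g, 𝔡 ⊓ (w (Fin.castLE g_le_m k)).toSubmodule ≠ ⊥
  one_le_finrank_u : 1 ≤ Module.finrank ℝ (𝔡 ⊓ 𝔩.toSubmodule : Submodule ℝ 𝔤)
  A : 𝔤 →ₗ[ℝ] 𝔤
  A_symmetric : A.IsSymmetric
  A_posDef : ∀ x, x ≠ 0 → 0 < inner ℝ (A x) x
  s : ℝ
  A_u : ∀ x ∈ 𝔡 ⊓ 𝔩.toSubmodule, A x = s • x
  A_d₀ : ∀ x ∈ 𝔡 ⊓ w₀, A x ∈ 𝔡 ⊓ w₀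
  A_d : ∀ k : Fin g, ∀ x ∈ 𝔡 ⊓ (w (Fin.castLE g_le_m k)).toSubmodule,
    A x ∈ 𝔡 ⊓ (w (Fin.castLE g_le_m k)).toSubmodule

namespace EPSData

variable {𝔤 : Type*} [NormedLieRing 𝔤] [InvariantInnerLieAlgebra 𝔤] (S : EPSData 𝔤)

/-- `𝔲 = 𝔡 ∩ 𝔩`. -/
def u : Submodule ℝ 𝔤 := S.𝔡 ⊓ S.𝔩.toSubmodule

/-- `𝔡₀ = 𝔡 ∩ 𝔴₀`. -/
def d₀ : Submodule ℝ 𝔤 := S.𝔡 ⊓ S.w₀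

/-- `𝔡_k = 𝔡 ∩ 𝔴_k`, `k = 1, …, g`. -/
def d (k : Fin S.g) : Submodule ℝ 𝔤 := S.𝔡 ⊓ (S.w (Fin.castLE S.g_le_m k)).toSubmodule

/-- `A - s · Id`, which on `𝔡_k` is the operator `B_k = A_k - s · Id_k`. -/
def B : 𝔤 →ₗ[ℝ] 𝔤 := S.A - S.s • LinearMap.id

/-- `B_k` is positive definite. -/
def BPosDef (k : Fin S.g) : Prop := ∀ ξ ∈ S.d k, ξ ≠ 0 → 0 < inner ℝ (S.B ξ) ξ

/-- The values of the quadratic form of `B_k` on the unit sphere of `𝔡_k`. -/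
def unitValues (k : Fin S.g) : Set ℝ := {r | ∃ ξ ∈ S.d k, ‖ξ‖ = 1 ∧ r = inner ℝ (S.B ξ) ξ}

/-- `F_k(x) = ⟨B_k x_k, x_k⟩`, where `x_k` is the orthogonal projection of `x` to `𝔡_k`. -/
noncomputable def F [FiniteDimensional ℝ 𝔤] (k : Fin S.g) (x : 𝔤) : ℝ :=
  inner ℝ (S.B ((S.d k).starProjection x)) ((S.d k).starProjection x)

/-- The common level set `x₀ = c₀`, `F_k = c_k` (`k = 1, …, g`), `⟨x, x⟩ = c_{g+1}` in `𝔡`. -/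
def levelSet [FiniteDimensional ℝ 𝔤] (c₀ : 𝔤) (c : Fin S.g → ℝ) (c' : ℝ) : Set 𝔤 :=
  {x | x ∈ S.𝔡 ∧ S.d₀.starProjection x = c₀ ∧ (∀ k, S.F k x = c k) ∧ inner ℝ x x = c'}

/-- `x` solves the Euler–Poincaré–Suslov equations `ẋ = [x, A x] + ∑ λ_i a^i`, `x ∈ 𝔡`, for times in
`I`, the `λ_i` being Lagrange multipliers and the `a^i` spanning `𝔥 = 𝔡ᗮ`.
As `A` preserves `𝔡`, for open `I` this says `x ∈ 𝔡` and `ẋ = [x, A x]_𝔡`. -/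
def IsSolutionOn (x : ℝ → 𝔤) (I : Set ℝ) : Prop :=
  ∀ t ∈ I, x t ∈ S.𝔡 ∧ ∃ v : 𝔤, HasDerivAt x v t ∧ v - ⁅x t, S.A (x t)⁆ ∈ S.𝔡ᗮ

/-- `M` is the disjoint union of `N` tori of dimension `r`, with angular coordinates `φ` in which
the Euler–Poincaré–Suslov equations read `φ̇_i = Ω_i / Φ(φ)`, where the `Ω_i` are constants and
`Φ` is a smooth positive function, `2π`-periodic in each variable. -/
def IsUnionOfTori (M : Set 𝔤) (N r : ℕ) : Prop :=
  ∃ (T : Fin N → Set 𝔤) (Ω : Fin r → ℝ),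
    M = ⋃ j, T j ∧ (∀ i j, i ≠ j → Disjoint (T i) (T j)) ∧
    ∀ j, ∃ (f : (Fin r → ℂ) → 𝔤) (f' : 𝔤 → (Fin r → ℂ)) (Φ : (Fin r → ℝ) → ℝ),
      IsDiffeoOn f f' (stdTorus r) (T j) ∧
      ContDiff ℝ ∞ Φ ∧ (∀ φ, 0 < Φ φ) ∧
      (∀ φ (i : Fin r), Φ (φ + Pi.single i (2 * Real.pi)) = Φ φ) ∧
      ∀ (I : Set ℝ) (φ : ℝ → Fin r → ℝ), IsOpen I → DifferentiableOn ℝ φ I →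
        (S.IsSolutionOn (fun t => f (torusPoint (φ t))) I ↔
          ∀ t ∈ I, HasDerivAt φ (fun i => Ω i / Φ (φ t)) t)

end EPSData

/-!
Write `x = y + x₀ + ∑ X_k` with `y ∈ 𝔲`, `x₀ ∈ 𝔡₀`, `X_k ∈ 𝔡_k`. Since `A` is scalar on `𝔲` and
`[𝔴, 𝔴] ⊆ 𝔨`, the projections of `[x, A x]` to `𝔡₀` and `𝔡_k` are `0` and `[y, B_k X_k]_{𝔡_k}`, and
the latter is tangent to the level sets of `F_k` by ad-invariance. So `M_c` is invariant. It
consists of the points with `X_k` on the ellipsoid `F_k = c_k` and with `y` on a sphere whose radius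
`ρ` depends on the `X_k`; the lower bound on `c_{g+1}` makes `ρ` positive, and radial projection
identifies `M_c` with a product of spheres.

If `𝔲` is the line spanned by a unit vector `e`, then `y = ±ρ e`, and `X ↦ [e, B_k X]_{𝔡_k}` is an
infinitesimal rotation of the ellipse in `𝔡_k` with a constant rate `ν_k`. In the angles of the
ellipses the equations become `φ̇_k = ρ(φ) ν_k`, hence `Φ = 1 / ρ`.
-/

open scoped InnerProductSpace

section SmoothOnSubset

variable {E F G : Type*} [NormedAddCommGroup E] [NormedSpace ℝ E]
  [NormedAddCommGroup F] [NormedSpace ℝ F] [NormedAddCommGroup G] [NormedSpace ℝ G]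

-- Being `C^∞` at a point does not propagate to a neighbourhood, being analytic does.
theorem smoothOnSubset_of_contDiffAt {f : E → F} {X : Set E}
    (hf : ∀ x ∈ X, ContDiffAt ℝ ω f x) : SmoothOnSubset f X := by
  intro x hx
  obtain ⟨U, hU, hUo, hxU⟩ := eventually_nhds_iff.1 ((hf x hx).eventually (by simp))
  exact ⟨U, hUo, hxU, f, fun y hy => ((hU y hy).of_le le_top).contDiffWithinAt, fun _ _ => rfl⟩

theorem SmoothOnSubset.comp {h : F → G} {f : E → F} {X : Set E} {Y : Set F}
    (hh : SmoothOnSubset h Y) (hf : SmoothOnSubset f X) (hXY : Set.MapsTo f X Y) :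
    SmoothOnSubset (h ∘ f) X := by
  intro x hx
  obtain ⟨U, hU, hxU, f₁, hf₁, hff₁⟩ := hf x hx
  obtain ⟨V, hV, hfxV, h₁, hh₁, hhh₁⟩ := hh (f x) (hXY hx)
  have hfx : f x = f₁ x := hff₁ ⟨hxU, hx⟩
  refine ⟨U ∩ f₁ ⁻¹' V, hf₁.continuousOn.isOpen_inter_preimage hU hV, ⟨hxU, hfx.subst hfxV⟩,
    h₁ ∘ f₁, hh₁.comp (hf₁.mono Set.inter_subset_left) fun y hy => hy.2, ?_⟩
  rintro y ⟨⟨hyU, hyV⟩, hyX⟩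
  have hfy : f y = f₁ y := hff₁ ⟨hyU, hyX⟩
  exact (hhh₁ ⟨hfy.symm.subst hyV, hXY hyX⟩).trans (congrArg h₁ hfy)

theorem IsDiffeoOn.symm {f : E → F} {f' : F → E} {X : Set E} {Y : Set F}
    (h : IsDiffeoOn f f' X Y) : IsDiffeoOn f' f Y X :=
  ⟨h.mapsTo_inv, h.mapsTo, h.invOn.symm, h.smooth_inv, h.smooth⟩

theorem IsDiffeoOn.trans {f : E → F} {f' : F → E} {h : F → G} {h' : G → F} {X : Set E} {Y : Set F}
    {Z : Set G} (hf : IsDiffeoOn f f' X Y) (hh : IsDiffeoOn h h' Y Z) :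
    IsDiffeoOn (h ∘ f) (f' ∘ h') X Z where
  mapsTo := hh.mapsTo.comp hf.mapsTo
  mapsTo_inv := hf.mapsTo_inv.comp hh.mapsTo_inv
  invOn := hf.invOn.comp hh.invOn hf.mapsTo hh.mapsTo_inv
  smooth := hh.smooth.comp hf.smooth hf.mapsTo
  smooth_inv := hf.smooth_inv.comp hh.smooth_inv hh.mapsTo_inv

end SmoothOnSubset

section Ellipsoid

variable {V : Type*} [NormedAddCommGroup V] [InnerProductSpace ℝ V] {T : V →ₗ[ℝ] V} {r : ℝ}

/-- The positive multiple of `ξ` on the ellipsoid `⟪T x, x⟫ = r`, for a positive definite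
operator `T`. -/
noncomputable def ellipsoidPoint (T : V →ₗ[ℝ] V) (r : ℝ) (ξ : V) : V := √(r / ⟪T ξ, ξ⟫_ℝ) • ξ

theorem inner_map_ellipsoidPoint {ξ : V} (hξ : 0 < ⟪T ξ, ξ⟫_ℝ) (hr : 0 ≤ r) :
    ⟪T (ellipsoidPoint T r ξ), ellipsoidPoint T r ξ⟫_ℝ = r := by
  rw [ellipsoidPoint, map_smul, inner_smul_left, inner_smul_right, RCLike.conj_to_real, ← mul_assoc,
    Real.mul_self_sqrt (by positivity), div_mul_cancel₀ r hξ.ne']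

theorem normalize_ellipsoidPoint {ξ : V} (hξ : 0 < ⟪T ξ, ξ⟫_ℝ) (hr : 0 < r) (hξ₁ : ‖ξ‖ = 1) :
    NormedSpace.normalize (ellipsoidPoint T r ξ) = ξ := by
  rw [ellipsoidPoint, NormedSpace.normalize_smul_of_pos (by positivity),
    NormedSpace.normalize_eq_self_of_norm_eq_one hξ₁]

theorem ellipsoidPoint_normalize {x : V} (hx : ⟪T x, x⟫_ℝ = r) (hr : r ≠ 0) :
    ellipsoidPoint T r (NormedSpace.normalize x) = x := by
  have hscale : r / ⟪T (NormedSpace.normalize x), NormedSpace.normalize x⟫_ℝ = ‖x‖ ^ 2 := by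
    rw [NormedSpace.normalize, map_smul, inner_smul_left, inner_smul_right, RCLike.conj_to_real, hx]
    field_simp
  rw [ellipsoidPoint, hscale, Real.sqrt_sq (norm_nonneg x), NormedSpace.norm_smul_normalize]

theorem contDiffAt_ellipsoidPoint [FiniteDimensional ℝ V] {n : WithTop ℕ∞} {ξ : V}
    (hξ : 0 < ⟪T ξ, ξ⟫_ℝ) (hr : r ≠ 0) : ContDiffAt ℝ n (ellipsoidPoint T r) ξ := by
  have hT : ContDiffAt ℝ n T ξ := T.toContinuousLinearMap.contDiff.contDiffAt
  exact ((contDiffAt_const.div (hT.inner ℝ contDiffAt_id) hξ.ne').sqrt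
    (div_ne_zero hr hξ.ne')).smul contDiffAt_id

theorem contDiffAt_normalize {n : WithTop ℕ∞} {x : V} (hx : x ≠ 0) :
    ContDiffAt ℝ n NormedSpace.normalize x :=
  ((contDiffAt_norm ℝ hx).inv (norm_ne_zero_iff.2 hx)).smul contDiffAt_id

theorem mul_norm_sq_le_inner_map {b : ℝ} (hb : ∀ ξ : V, ‖ξ‖ = 1 → b ≤ ⟪T ξ, ξ⟫_ℝ) (x : V) :
    b * ‖x‖ ^ 2 ≤ ⟪T x, x⟫_ℝ := by
  rcases eq_or_ne x 0 with rfl | hx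
  · simp
  · calc b * ‖x‖ ^ 2
        ≤ ⟪T (NormedSpace.normalize x), NormedSpace.normalize x⟫_ℝ * ‖x‖ ^ 2 := by
          gcongr; exact hb _ (NormedSpace.norm_normalize hx)
      _ = ⟪T (‖x‖ • NormedSpace.normalize x), ‖x‖ • NormedSpace.normalize x⟫_ℝ := by
          rw [map_smul, inner_smul_left, inner_smul_right, RCLike.conj_to_real]; ring
      _ = ⟪T x, x⟫_ℝ := by rw [NormedSpace.norm_smul_normalize]

end Ellipsoid

section UnitSpheres

variable {ι : Type*} {V V' : ι → Type*} [∀ k, NormedAddCommGroup (V k)]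
  [∀ k, NormedAddCommGroup (V' k)] {W W' : Type*} [NormedAddCommGroup W] [NormedAddCommGroup W']

variable (V W) in
/-- The product of the unit spheres of the `V k` and of `W`. -/
def unitSpheres : Set ((∀ k, V k) × W) := {p | (∀ k, ‖p.1 k‖ = 1) ∧ ‖p.2‖ = 1}

theorem isDiffeoOn_unitSpheres [Fintype ι] [∀ k, NormedSpace ℝ (V k)] [∀ k, NormedSpace ℝ (V' k)]
    [NormedSpace ℝ W] [NormedSpace ℝ W'] (e : ∀ k, V k ≃ₗᵢ[ℝ] V' k) (e' : W ≃ₗᵢ[ℝ] W') :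
    IsDiffeoOn (fun p : (∀ k, V k) × W => (fun k => e k (p.1 k), e' p.2))
      (fun p : (∀ k, V' k) × W' => (fun k => (e k).symm (p.1 k), e'.symm p.2))
      (unitSpheres V W) (unitSpheres V' W') where
  mapsTo p hp := ⟨fun k => by simpa using hp.1 k, by simpa using hp.2⟩
  mapsTo_inv p hp := ⟨fun k => by simpa using hp.1 k, by simpa using hp.2⟩
  invOn := ⟨fun p _ => by simp, fun p _ => by simp⟩
  smooth := smoothOnSubset_of_contDiffAt fun p _ =>
    (contDiffAt_pi.2 fun k => (e k).contDiff.contDiffAt.comp p (contDiffAt_pi.1 contDiffAt_fst k))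
      |>.prodMk (e'.contDiff.contDiffAt.comp p contDiffAt_snd)
  smooth_inv := smoothOnSubset_of_contDiffAt fun p _ =>
    (contDiffAt_pi.2 fun k =>
      (e k).symm.contDiff.contDiffAt.comp p (contDiffAt_pi.1 contDiffAt_fst k))
      |>.prodMk (e'.symm.contDiff.contDiffAt.comp p contDiffAt_snd)

end UnitSpheres

section EllipsoidsInSphere

variable {ι : Type*} [Fintype ι] {V : ι → Type*} [∀ k, NormedAddCommGroup (V k)]
  [∀ k, InnerProductSpace ℝ (V k)] {W : Type*} [NormedAddCommGroup W]

/-- The part of the sphere `∑ ‖X k‖ ^ 2 + ‖y‖ ^ 2 = R` where each `X k` lies on the quadric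
`⟪T k (X k), X k⟫ = c k`. -/
def ellipsoidsInSphere (T : ∀ k, V k →ₗ[ℝ] V k) (c : ι → ℝ) (R : ℝ) : Set ((∀ k, V k) × W) :=
  {p | (∀ k, ⟪T k (p.1 k), p.1 k⟫_ℝ = c k) ∧ ∑ k, ‖p.1 k‖ ^ 2 + ‖p.2‖ ^ 2 = R}

variable {T : ∀ k, V k →ₗ[ℝ] V k} {c : ι → ℝ} {R : ℝ}

theorem sum_norm_sq_lt_of_le {b : ι → ℝ} (hb : ∀ k, 0 < b k)
    (hTb : ∀ k ξ, ‖ξ‖ = 1 → b k ≤ ⟪T k ξ, ξ⟫_ℝ) (hR : ∑ k, c k / b k < R) {X : ∀ k, V k}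
    (hX : ∀ k, ⟪T k (X k), X k⟫_ℝ = c k) : ∑ k, ‖X k‖ ^ 2 < R := by
  refine (Finset.sum_le_sum fun k _ => ?_).trans_lt hR
  rw [le_div_iff₀' (hb k), ← hX k]
  exact mul_norm_sq_le_inner_map (hTb k) (X k)

variable [InnerProductSpace ℝ W]

-- Radial projection of each factor; in the inverse, the last factor gets the radius that is left.
theorem isDiffeoOn_ellipsoidsInSphere [∀ k, FiniteDimensional ℝ (V k)]
    (hT : ∀ k ξ, ξ ≠ 0 → 0 < ⟪T k ξ, ξ⟫_ℝ) (hc : ∀ k, 0 < c k)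
    (hR : ∀ X : ∀ k, V k, (∀ k, ⟪T k (X k), X k⟫_ℝ = c k) → ∑ k, ‖X k‖ ^ 2 < R) :
    IsDiffeoOn
      (fun p : (∀ k, V k) × W =>
        (fun k => NormedSpace.normalize (p.1 k), NormedSpace.normalize p.2))
      (fun p => (fun k => ellipsoidPoint (T k) (c k) (p.1 k),
        √(R - ∑ k, ‖ellipsoidPoint (T k) (c k) (p.1 k)‖ ^ 2) • p.2))
      (ellipsoidsInSphere T c R) (unitSpheres V W) := by
  have hX₀ : ∀ p ∈ ellipsoidsInSphere (W := W) T c R, ∀ k, p.1 k ≠ 0 := fun p hp k h =>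
    (hc k).ne (by simpa [h] using hp.1 k)
  have hy : ∀ p ∈ ellipsoidsInSphere (W := W) T c R, R - ∑ k, ‖p.1 k‖ ^ 2 = ‖p.2‖ ^ 2 :=
    fun p hp => by rw [← hp.2, add_sub_cancel_left]
  have hy₀ : ∀ p ∈ ellipsoidsInSphere (W := W) T c R, p.2 ≠ 0 := fun p hp h =>
    (sub_pos.2 (hR p.1 hp.1)).ne' (by simp [hy p hp, h])
  have hpos : ∀ p ∈ unitSpheres V W, ∀ k, 0 < ⟪T k (p.1 k), p.1 k⟫_ℝ := fun p hp k =>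
    hT k _ (norm_ne_zero_iff.1 (by simp [hp.1 k]))
  have hrad : ∀ p ∈ unitSpheres V W, 0 < R - ∑ k, ‖ellipsoidPoint (T k) (c k) (p.1 k)‖ ^ 2 :=
    fun p hp => sub_pos.2 (hR _ fun k => inner_map_ellipsoidPoint (hpos p hp k) (hc k).le)
  refine ⟨fun p hp => ⟨fun k => NormedSpace.norm_normalize (hX₀ p hp k),
      NormedSpace.norm_normalize (hy₀ p hp)⟩, fun p hp => ⟨fun k =>
      inner_map_ellipsoidPoint (hpos p hp k) (hc k).le, ?_⟩, ⟨fun p hp => ?_, fun p hp => ?_⟩,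
    smoothOnSubset_of_contDiffAt fun p hp => ?_, smoothOnSubset_of_contDiffAt fun p hp => ?_⟩
  · rw [norm_smul, hp.2, mul_one, Real.norm_eq_abs, sq_abs, Real.sq_sqrt (hrad p hp).le,
      add_sub_cancel]
  · simp only [ellipsoidPoint_normalize (hp.1 _) (hc _).ne', hy p hp, Real.sqrt_sq (norm_nonneg _),
      NormedSpace.norm_smul_normalize]
  · simp only [normalize_ellipsoidPoint (hpos p hp _) (hc _) (hp.1 _),
      NormedSpace.normalize_smul_of_pos (Real.sqrt_pos.2 (hrad p hp)),
      NormedSpace.normalize_eq_self_of_norm_eq_one hp.2]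
  · exact (contDiffAt_pi.2 fun k => (contDiffAt_normalize (hX₀ p hp k)).comp p
      (contDiffAt_pi.1 contDiffAt_fst k)).prodMk
        ((contDiffAt_normalize (hy₀ p hp)).comp p contDiffAt_snd)
  · have hX : ∀ k, ContDiffAt ℝ ω
        (fun p : (∀ k, V k) × W => ellipsoidPoint (T k) (c k) (p.1 k)) p := fun k =>
      (contDiffAt_ellipsoidPoint (hpos p hp k) (hc k).ne').comp p (contDiffAt_pi.1 contDiffAt_fst k)
    exact (contDiffAt_pi.2 hX).prodMk (((contDiffAt_const.sub
      (ContDiffAt.sum fun k _ => (hX k).norm_sq ℝ)).sqrt (hrad p hp).ne').smul contDiffAt_snd)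

end EllipsoidsInSphere

section EllipseFrame

variable {V : Type*} [NormedAddCommGroup V] [InnerProductSpace ℝ V] {T N : V →ₗ[ℝ] V} {r ν : ℝ}
  {p q : V}

/-- Conjugate semi-axes `p` and `q` of the ellipse `⟪T x, x⟫ = r` in a plane `V`, on which the
linear vector field `N` is the infinitesimal rotation with rate `ν`. If `V` is a line, the
ellipse is the pair of points `± p`, and `q = 0`. -/
structure EllipseFrame (T N : V →ₗ[ℝ] V) (r : ℝ) (p q : V) (ν : ℝ) : Prop where
  inner_left : ⟪T p, p⟫_ℝ = r
  inner_left_right : ⟪T p, q⟫_ℝ = 0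
  inner_right_left : ⟪T q, p⟫_ℝ = 0
  inner_right : Module.finrank ℝ V = 2 → ⟪T q, q⟫_ℝ = r
  right_eq_zero : Module.finrank ℝ V ≠ 2 → q = 0
  exists_eq : ∀ x, ∃ a b : ℝ, x = a • p + b • q
  map_left : N p = ν • q
  map_right : N q = -(ν • p)

theorem exists_ellipseFrame_of_finrank_eq_one (hT : ∀ ξ, ξ ≠ 0 → 0 < ⟪T ξ, ξ⟫_ℝ) (hr : 0 < r)
    (hN : ∀ x, ⟪T (N x), x⟫_ℝ = 0) (hV : Module.finrank ℝ V = 1) :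
    ∃ p q ν, EllipseFrame T N r p q ν := by
  obtain ⟨ξ, hξ⟩ : ∃ ξ : V, ξ ≠ 0 :=
    have := Module.nontrivial_of_finrank_pos (R := ℝ) (M := V) (by omega)
    exists_ne 0
  set p := ellipsoidPoint T r ξ
  have hTp : ⟪T p, p⟫_ℝ = r := inner_map_ellipsoidPoint (hT ξ hξ) hr.le
  have hp₀ : p ≠ 0 := fun h => hr.ne (by simpa [h] using hTp)
  have hspan : ∀ x, ∃ a : ℝ, a • p = x := exists_smul_eq_of_finrank_eq_one hV hp₀
  have hNp : N p = 0 := by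
    obtain ⟨a, ha⟩ := hspan (N p)
    have h : a * r = 0 := by
      rw [← hN p, ← ha, map_smul, inner_smul_left, hTp, RCLike.conj_to_real]
    rw [← ha, (mul_eq_zero.1 h).resolve_right hr.ne', zero_smul]
  refine ⟨p, 0, 0, hTp, by simp, by simp, fun h => by omega, fun _ => rfl, fun x => ?_,
    by simpa using hNp, by simp⟩
  obtain ⟨a, rfl⟩ := hspan x
  exact ⟨a, 0, by simp⟩

theorem exists_map_eq_smul_of_conjugate (hr : r ≠ 0) (hN : ∀ x, ⟪T (N x), x⟫_ℝ = 0)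
    (hp : ⟪T p, p⟫_ℝ = r) (hq : ⟪T q, q⟫_ℝ = r) (hpq : ⟪T p, q⟫_ℝ = 0) (hqp : ⟪T q, p⟫_ℝ = 0)
    (hspan : ∀ x, ∃ a b : ℝ, x = a • p + b • q) : ∃ ν : ℝ, N p = ν • q ∧ N q = -(ν • p) := by
  obtain ⟨a, ν, ha⟩ := hspan (N p)
  obtain ⟨a', b', hb⟩ := hspan (N q)
  have hNpp := hN p
  have hNqq := hN q
  have hNpq := hN (p + q)
  simp only [map_add, ha, hb, map_smul, inner_add_left, inner_add_right, inner_smul_left,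
    RCLike.conj_to_real, hp, hq, hpq, hqp, mul_zero, add_zero, zero_add] at hNpp hNqq hNpq
  obtain rfl : a = 0 := (mul_eq_zero.1 hNpp).resolve_right hr
  obtain rfl : b' = 0 := (mul_eq_zero.1 hNqq).resolve_right hr
  obtain rfl : a' = -ν := by
    have h : (a' + ν) * r = 0 := by linear_combination hNpq
    linarith [(mul_eq_zero.1 h).resolve_right hr]
  exact ⟨ν, by simpa using ha, by simpa using hb⟩

theorem exists_ellipseFrame_of_finrank_eq_two [FiniteDimensional ℝ V] (hTs : T.IsSymmetric)
    (hT : ∀ ξ, ξ ≠ 0 → 0 < ⟪T ξ, ξ⟫_ℝ) (hr : 0 < r) (hN : ∀ x, ⟪T (N x), x⟫_ℝ = 0)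
    (hV : Module.finrank ℝ V = 2) : ∃ p q ν, EllipseFrame T N r p q ν := by
  set v := hTs.eigenvectorBasis hV with hv
  set s : Fin 2 → ℝ := fun i => √(r / ⟪T (v i), v i⟫_ℝ)
  have hTv : ∀ i, 0 < ⟪T (v i), v i⟫_ℝ := fun i => hT _ (v.orthonormal.ne_zero i)
  have hs₀ : ∀ i, s i ≠ 0 := fun i => (Real.sqrt_pos.2 (div_pos hr (hTv i))).ne'
  have horth : ∀ i j, i ≠ j →
      ⟪T (ellipsoidPoint T r (v i)), ellipsoidPoint T r (v j)⟫_ℝ = 0 := fun i j hij => by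
    rw [ellipsoidPoint, ellipsoidPoint, map_smul, hTs.apply_eigenvectorBasis hV i]
    simp [inner_smul_left, inner_smul_right, ← hv, v.orthonormal.2 hij]
  have hself : ∀ i, ⟪T (ellipsoidPoint T r (v i)), ellipsoidPoint T r (v i)⟫_ℝ = r := fun i =>
    inner_map_ellipsoidPoint (hTv i) hr.le
  have hspan : ∀ x, ∃ a b : ℝ,
      x = a • ellipsoidPoint T r (v 0) + b • ellipsoidPoint T r (v 1) := fun x => by
    refine ⟨⟪v 0, x⟫_ℝ / s 0, ⟪v 1, x⟫_ℝ / s 1, ?_⟩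
    change x = _ • (s 0 • v 0) + _ • (s 1 • v 1)
    rw [smul_smul, smul_smul, div_mul_cancel₀ _ (hs₀ 0), div_mul_cancel₀ _ (hs₀ 1),
      ← Fin.sum_univ_two fun i => ⟪v i, x⟫_ℝ • v i, v.sum_repr']
  obtain ⟨ν, hp, hq⟩ := exists_map_eq_smul_of_conjugate hr.ne' hN (hself 0) (hself 1)
    (horth 0 1 (by decide)) (horth 1 0 (by decide)) hspan
  exact ⟨_, _, ν, hself 0, horth 0 1 (by decide), horth 1 0 (by decide), fun _ => hself 1,
    fun h => (h hV).elim, hspan, hp, hq⟩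

theorem EllipseFrame.flip (h : EllipseFrame T N r p q ν) (σ τ : ℤˣ) :
    EllipseFrame T (σ • N) r (τ • p) ((σ * τ) • q) ν := by
  obtain ⟨hp, hpq, hqp, hq, hq₀, hspan, hNp, hNq⟩ := h
  refine ⟨?_, ?_, ?_, fun hV => ?_, fun hV => ?_, fun x => ?_, ?_, ?_⟩
  case refine_6 =>
    obtain ⟨a, b, rfl⟩ := hspan x
    refine ⟨a * (τ : ℤ), b * ((σ * τ : ℤˣ) : ℤ), ?_⟩
    rcases Int.units_eq_one_or σ with rfl | rfl <;> rcases Int.units_eq_one_or τ with rfl | rfl <;>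
      simp
  all_goals
    rcases Int.units_eq_one_or σ with rfl | rfl <;> rcases Int.units_eq_one_or τ with rfl | rfl <;>
      simp_all

/-- The parametrization `exp(i φ) ↦ cos φ p + sin φ q` of the ellipse with conjugate semi-axes `p`
and `q`, extended linearly to the whole complex plane. -/
noncomputable def ellipsePoint (p q : V) : ℂ →L[ℝ] V :=
  Complex.reCLM.smulRight p + Complex.imCLM.smulRight q

theorem ellipsePoint_apply (p q : V) (w : ℂ) : ellipsePoint p q w = w.re • p + w.im • q := rfl

/-- The inverse of `ellipsePoint` on the ellipse `⟪T x, x⟫ = r`. -/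
noncomputable def ellipseCoord (T : V →ₗ[ℝ] V) (r : ℝ) (p q x : V) : ℂ :=
  ⟨⟪T p, x⟫_ℝ / r, ⟪T q, x⟫_ℝ / r⟩

namespace EllipseFrame

theorem ellipsePoint_ellipseCoord (h : EllipseFrame T N r p q ν) (hr : r ≠ 0) (x : V) :
    ellipsePoint p q (ellipseCoord T r p q x) = x := by
  obtain ⟨a, b, rfl⟩ := h.exists_eq x
  by_cases hV : Module.finrank ℝ V = 2
  · simp [ellipsePoint_apply, ellipseCoord, inner_add_right, inner_smul_right, h.inner_left,
      h.inner_left_right, h.inner_right_left, h.inner_right hV, hr]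
  · obtain rfl := h.right_eq_zero hV
    simp [ellipsePoint_apply, ellipseCoord, inner_smul_right, h.inner_left, hr]

theorem ellipseCoord_ellipsePoint (h : EllipseFrame T N r p q ν) (hr : r ≠ 0)
    (hV : Module.finrank ℝ V = 2) (w : ℂ) : ellipseCoord T r p q (ellipsePoint p q w) = w := by
  simp [ellipsePoint_apply, ellipseCoord, inner_add_right, inner_smul_right, h.inner_left,
    h.inner_left_right, h.inner_right_left, h.inner_right hV, hr]

theorem inner_ellipsePoint_of_finrank_eq_two (h : EllipseFrame T N r p q ν)
    (hV : Module.finrank ℝ V = 2) (w : ℂ) :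
    ⟪T (ellipsePoint p q w), ellipsePoint p q w⟫_ℝ = r * ‖w‖ ^ 2 := by
  simp only [ellipsePoint_apply, map_add, map_smul, inner_add_left, inner_add_right,
    inner_smul_left, inner_smul_right, RCLike.conj_to_real, h.inner_left, h.inner_left_right,
    h.inner_right_left, h.inner_right hV, Complex.sq_norm, Complex.normSq_apply]
  ring

theorem ellipsePoint_of_finrank_ne_two (h : EllipseFrame T N r p q ν)
    (hV : Module.finrank ℝ V ≠ 2) (w : ℂ) : ellipsePoint p q w = w.re • p := by
  rw [ellipsePoint_apply, h.right_eq_zero hV, smul_zero, add_zero]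

theorem norm_ellipseCoord (h : EllipseFrame T N r p q ν) (hr : r ≠ 0)
    (hV : Module.finrank ℝ V = 2) {x : V} (hx : ⟪T x, x⟫_ℝ = r) :
    ‖ellipseCoord T r p q x‖ = 1 := by
  have hsq := h.inner_ellipsePoint_of_finrank_eq_two hV (ellipseCoord T r p q x)
  rw [h.ellipsePoint_ellipseCoord hr, hx, eq_comm, mul_eq_left₀ hr] at hsq
  exact (pow_eq_one_iff_of_nonneg (norm_nonneg _) two_ne_zero).1 hsq

theorem eq_of_finrank_ne_two (h : EllipseFrame T N r p q ν) (hr : 0 < r)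
    (hV : Module.finrank ℝ V ≠ 2) {x : V} (hx : ⟪T x, x⟫_ℝ = r) (hpx : 0 < ⟪T p, x⟫_ℝ) :
    x = p := by
  obtain ⟨a, b, rfl⟩ := h.exists_eq x
  rw [h.right_eq_zero hV, smul_zero, add_zero] at hx hpx ⊢
  simp only [map_smul, inner_smul_left, inner_smul_right, RCLike.conj_to_real,
    h.inner_left] at hx hpx
  have ha : 0 < a := pos_of_mul_pos_left hpx hr.le
  have ha₁ : a ^ 2 = 1 := mul_right_cancel₀ hr.ne' (by linear_combination hx)
  rw [(pow_eq_one_iff_of_nonneg ha.le two_ne_zero).1 ha₁, one_smul]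

theorem map_ellipsePoint (h : EllipseFrame T N r p q ν) (w : ℂ) :
    N (ellipsePoint p q w) = ν • ellipsePoint p q (Complex.I * w) := by
  simp only [ellipsePoint_apply, map_add, map_smul, h.map_left, h.map_right, Complex.I_mul_re,
    Complex.I_mul_im]
  module

end EllipseFrame

end EllipseFrame

namespace InvariantInnerLieAlgebra

variable {L : Type*} [NormedLieRing L] [InvariantInnerLieAlgebra L]

theorem inner_lie_right_self (x y : L) : ⟪⁅x, y⁆, y⟫_ℝ = 0 := by
  rw [inner_lie, lie_self, inner_zero_right]

theorem inner_left_self_lie (x y : L) : ⟪x, ⁅x, y⁆⟫_ℝ = 0 := by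
  rw [← inner_lie, lie_self, inner_zero_left]

end InvariantInnerLieAlgebra

namespace EPSData

variable {𝔤 : Type*} [NormedLieRing 𝔤] [InvariantInnerLieAlgebra 𝔤] (S : EPSData 𝔤)

theorem 𝔡_eq : S.𝔡 = S.u ⊔ S.d₀ ⊔ ⨆ k, S.d k := S.𝔡_sum

theorem u_le : S.u ≤ S.𝔨.toSubmodule := inf_le_right.trans S.𝔩_le_𝔨

theorem w_le (j : Fin S.m) : (S.w j).toSubmodule ≤ S.𝔨.toSubmoduleᗮ :=
  S.w_sum ▸ (le_iSup (fun j => (S.w j).toSubmodule) j).trans le_sup_right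

theorem d₀_le : S.d₀ ≤ S.𝔨.toSubmoduleᗮ :=
  inf_le_right.trans (S.w_sum ▸ le_sup_left)

theorem d_le (k : Fin S.g) : S.d k ≤ S.𝔨.toSubmoduleᗮ := inf_le_right.trans (S.w_le _)

theorem u_isOrtho_d₀ : S.u ⟂ S.d₀ :=
  (Submodule.isOrtho_orthogonal_right _).mono S.u_le S.d₀_le

theorem u_isOrtho_d (k : Fin S.g) : S.u ⟂ S.d k :=
  (Submodule.isOrtho_orthogonal_right _).mono S.u_le (S.d_le k)

theorem d₀_isOrtho_d (k : Fin S.g) : S.d₀ ⟂ S.d k :=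
  (S.w₀_orthogonal _).mono inf_le_right inf_le_right

theorem d_isOrtho_d {j k : Fin S.g} (h : j ≠ k) : S.d j ⟂ S.d k :=
  (S.w_orthogonal _ _ ((Fin.castLE_injective S.g_le_m).ne h)).mono inf_le_right inf_le_right

theorem B_isSymmetric : S.B.IsSymmetric := fun x y => by
  simp only [B, LinearMap.sub_apply, LinearMap.smul_apply, LinearMap.id_apply, inner_sub_left,
    inner_sub_right, inner_smul_left, inner_smul_right, RCLike.conj_to_real, S.A_symmetric x y]

theorem B_eq_zero (y : S.u) : S.B y = 0 := sub_eq_zero.2 (S.A_u y y.2)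

theorem B_mem_d₀ {x : 𝔤} (hx : x ∈ S.d₀) : S.B x ∈ S.d₀ :=
  S.d₀.sub_mem (S.A_d₀ x hx) (S.d₀.smul_mem _ hx)

theorem B_mem_d {k : Fin S.g} {x : 𝔤} (hx : x ∈ S.d k) : S.B x ∈ S.d k :=
  (S.d k).sub_mem (S.A_d k x hx) ((S.d k).smul_mem _ hx)

theorem lie_A (x : 𝔤) : ⁅x, S.A x⁆ = ⁅x, S.B x⁆ := by simp [B]

/-- The operator `B_k` on `𝔡_k`. -/
def Bd (k : Fin S.g) : S.d k →ₗ[ℝ] S.d k := S.B.restrict fun _ => S.B_mem_d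

theorem Bd_isSymmetric (k : Fin S.g) : (S.Bd k).IsSymmetric :=
  fun X Y => S.B_isSymmetric X Y

section Assemble

/-- The vector `y + x₀ + ∑ X_k` of `𝔡` with components `x₀ ∈ 𝔡₀` and `((X_k), y)`. -/
def assemble (x₀ : S.d₀) (p : (∀ k, S.d k) × S.u) : 𝔤 := p.2 + x₀ + ∑ k, (p.1 k : 𝔤)

variable {S} (x₀ : S.d₀) (p : (∀ k, S.d k) × S.u)

theorem assemble_mem : S.assemble x₀ p ∈ S.𝔡 :=
  S.𝔡.add_mem (S.𝔡.add_mem p.2.2.1 x₀.2.1) (S.𝔡.sum_mem fun k _ => (p.1 k).2.1)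

theorem inner_u_assemble (y : S.u) : ⟪(y : 𝔤), S.assemble x₀ p⟫_ℝ = ⟪y, p.2⟫_ℝ := by
  rw [assemble, inner_add_right, inner_add_right, inner_sum, S.u_isOrtho_d₀.inner_eq y.2 x₀.2,
    Finset.sum_eq_zero fun k _ => (S.u_isOrtho_d k).inner_eq y.2 (p.1 k).2, add_zero, add_zero]
  rfl

theorem inner_d₀_assemble (a : S.d₀) : ⟪(a : 𝔤), S.assemble x₀ p⟫_ℝ = ⟪a, x₀⟫_ℝ := by
  rw [assemble, inner_add_right, inner_add_right, inner_sum,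
    S.u_isOrtho_d₀.symm.inner_eq a.2 p.2.2,
    Finset.sum_eq_zero fun k _ => (S.d₀_isOrtho_d k).inner_eq a.2 (p.1 k).2, zero_add, add_zero]
  rfl

theorem inner_d_assemble {k : Fin S.g} (a : S.d k) :
    ⟪(a : 𝔤), S.assemble x₀ p⟫_ℝ = ⟪a, p.1 k⟫_ℝ := by
  rw [assemble, inner_add_right, inner_add_right, inner_sum,
    (S.u_isOrtho_d k).symm.inner_eq a.2 p.2.2, (S.d₀_isOrtho_d k).symm.inner_eq a.2 x₀.2,
    Finset.sum_eq_single_of_mem k (Finset.mem_univ k) fun j _ hj =>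
      (S.d_isOrtho_d hj.symm).inner_eq a.2 (p.1 j).2, add_zero, zero_add]
  rfl

theorem inner_assemble_assemble (x₀' : S.d₀) (p' : (∀ k, S.d k) × S.u) :
    ⟪S.assemble x₀ p, S.assemble x₀' p'⟫_ℝ
      = ⟪p.2, p'.2⟫_ℝ + ⟪x₀, x₀'⟫_ℝ + ∑ k, ⟪p.1 k, p'.1 k⟫_ℝ := by
  rw [assemble, inner_add_left, inner_add_left, sum_inner, inner_u_assemble, inner_d₀_assemble]
  simp only [inner_d_assemble]

theorem norm_sq_assemble :
    ‖S.assemble x₀ p‖ ^ 2 = ‖x₀‖ ^ 2 + (∑ k, ‖p.1 k‖ ^ 2 + ‖p.2‖ ^ 2) := by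
  simp only [← real_inner_self_eq_norm_sq, inner_assemble_assemble]
  ring

variable [FiniteDimensional ℝ 𝔤]

variable (S) in
/-- The components `((x_k), x_𝔲)` of a vector `x`; the component in `𝔡₀` is left out. -/
noncomputable def components : 𝔤 →L[ℝ] (∀ k, S.d k) × S.u :=
  (ContinuousLinearMap.pi fun k => (S.d k).orthogonalProjectionOnto).prod
    S.u.orthogonalProjectionOnto

theorem components_fst (x : 𝔤) (k : Fin S.g) :
    (S.components x).1 k = (S.d k).orthogonalProjectionOnto x := rfl

theorem components_snd (x : 𝔤) : (S.components x).2 = S.u.orthogonalProjectionOnto x := rfl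

theorem components_assemble : S.components (S.assemble x₀ p) = p := by
  refine Prod.ext (funext fun k => ext_inner_left ℝ fun a => ?_) (ext_inner_left ℝ fun y => ?_)
  · rw [components_fst, Submodule.inner_orthogonalProjectionOnto_eq_of_mem_left, inner_d_assemble]
  · rw [components_snd, Submodule.inner_orthogonalProjectionOnto_eq_of_mem_left, inner_u_assemble]

theorem orthogonalProjectionOnto_d₀_assemble :
    S.d₀.orthogonalProjectionOnto (S.assemble x₀ p) = x₀ :=
  ext_inner_left ℝ fun a => by
    rw [Submodule.inner_orthogonalProjectionOnto_eq_of_mem_left, inner_d₀_assemble]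

theorem mem_orthogonal_𝔡_iff {v : 𝔤} :
    v ∈ S.𝔡ᗮ ↔ S.d₀.orthogonalProjectionOnto v = 0 ∧ S.components v = 0 := by
  simp only [𝔡_eq, ← Submodule.inf_orthogonal, ← Submodule.iInf_orthogonal, Submodule.mem_inf,
    Submodule.mem_iInf, Prod.ext_iff, funext_iff, Prod.fst_zero, Prod.snd_zero, Pi.zero_apply,
    components_fst, components_snd, Submodule.orthogonalProjectionOnto_eq_zero_iff]
  tauto

theorem assemble_components {x : 𝔤} (hx : x ∈ S.𝔡) :
    S.assemble (S.d₀.orthogonalProjectionOnto x) (S.components x) = x := by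
  refine sub_eq_zero.1 (Submodule.inf_orthogonal_eq_bot S.𝔡 |>.le
    ⟨S.𝔡.sub_mem (assemble_mem _ _) hx, mem_orthogonal_𝔡_iff.2 ?_⟩)
  simp only [map_sub, components_assemble, orthogonalProjectionOnto_d₀_assemble, sub_self, and_self]

end Assemble

end EPSData

namespace EPSData

variable {𝔤 : Type*} [NormedLieRing 𝔤] [InvariantInnerLieAlgebra 𝔤] {S : EPSData 𝔤}

theorem contDiff_assemble {n : WithTop ℕ∞} (x₀ : S.d₀) : ContDiff ℝ n (S.assemble x₀) :=
  ((S.u.subtypeₗᵢ.contDiff.comp contDiff_snd).add contDiff_const).add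
    (ContDiff.sum fun k _ => (S.d k).subtypeₗᵢ.contDiff.comp (contDiff_pi.1 contDiff_fst k))

theorem hasDerivAt_assemble (x₀ : S.d₀) {p : ℝ → (∀ k, S.d k) × S.u} {v : (∀ k, S.d k) × S.u}
    {t : ℝ} (hp : HasDerivAt p v t) :
    HasDerivAt (fun t => S.assemble x₀ (p t)) (S.assemble 0 v) t := by
  have hu := S.u.subtypeL.hasFDerivAt.comp_hasDerivAt t hp.snd
  have hd := fun k => (S.d k).subtypeL.hasFDerivAt.comp_hasDerivAt t (hasDerivAt_pi.1 hp.fst k)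
  refine ((hu.add_const (x₀ : 𝔤)).add (HasDerivAt.fun_sum fun k _ => hd k)).congr_deriv ?_
  simp [assemble]

theorem B_assemble (x₀ : S.d₀) (p : (∀ k, S.d k) × S.u) :
    S.B (S.assemble x₀ p) = S.B x₀ + ∑ k, S.B (p.1 k) := by
  rw [assemble, map_add, map_add, map_sum, S.B_eq_zero, zero_add]

theorem lie_u_d₀ (y : S.u) {x : 𝔤} (hx : x ∈ S.d₀) : ⁅(y : 𝔤), x⁆ = 0 :=
  ((S.mem_w₀ x).1 hx.2).2 y y.2.2

theorem lie_u_mem_w (y : S.u) {k : Fin S.g} {x : 𝔤} (hx : x ∈ S.d k) :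
    ⁅(y : 𝔤), x⁆ ∈ (S.w (Fin.castLE S.g_le_m k)).toSubmodule :=
  (S.w _).lie_mem (x := (⟨y, y.2.2⟩ : S.𝔩)) hx.2

-- The component of `x` in `𝔴` contributes only to `[𝔴, 𝔴] ⊆ 𝔨`, which is orthogonal to `𝔴`.
theorem inner_lie_assemble {a : 𝔤} (ha : a ∈ S.𝔨.toSubmoduleᗮ) (x₀ : S.d₀)
    (p : (∀ k, S.d k) × S.u) :
    ⟪a, ⁅S.assemble x₀ p, S.A (S.assemble x₀ p)⁆⟫_ℝ = ∑ k, ⟪a, ⁅(p.2 : 𝔤), S.B (p.1 k)⁆⟫_ℝ := by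
  have hw : (x₀ : 𝔤) + ∑ k, (p.1 k : 𝔤) ∈ S.𝔨.toSubmoduleᗮ :=
    add_mem (S.d₀_le x₀.2) (sum_mem fun k _ => S.d_le k (p.1 k).2)
  have hBw : S.B x₀ + ∑ k, S.B (p.1 k) ∈ S.𝔨.toSubmoduleᗮ :=
    add_mem (S.d₀_le (S.B_mem_d₀ x₀.2)) (sum_mem fun k _ => S.d_le k (S.B_mem_d (p.1 k).2))
  rw [lie_A, B_assemble, assemble, add_assoc, add_lie, inner_add_right,
    Submodule.inner_left_of_mem_orthogonal (S.symmetricPair.lie_perp_perp _ hw _ hBw) ha, add_zero,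
    lie_add, lie_u_d₀ _ (S.B_mem_d₀ x₀.2), zero_add, lie_sum, inner_sum]

theorem inner_eq_zero_of_sub_lie_mem {x v : 𝔤} (hx : x ∈ S.𝔡) (hv : v - ⁅x, S.A x⁆ ∈ S.𝔡ᗮ) :
    ⟪x, v⟫_ℝ = 0 := by
  have h := Submodule.inner_right_of_mem_orthogonal hx hv
  rwa [inner_sub_right, InvariantInnerLieAlgebra.inner_left_self_lie, sub_zero] at h

theorem IsSolutionOn.eq_of_hasDerivAt_zero {E : Type*} [NormedAddCommGroup E] [NormedSpace ℝ E]
    {f : 𝔤 → E} {γ : ℝ → 𝔤} {I : Set ℝ} (hγ : S.IsSolutionOn γ I) (hI : IsOpen I)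
    (hc : I.OrdConnected)
    (hf : ∀ (t : ℝ) (v : 𝔤), γ t ∈ S.𝔡 → HasDerivAt γ v t → v - ⁅γ t, S.A (γ t)⁆ ∈ S.𝔡ᗮ →
      HasDerivAt (f ∘ γ) 0 t)
    {t₀ t : ℝ} (h₀ : t₀ ∈ I) (ht : t ∈ I) : f (γ t) = f (γ t₀) := by
  have hderiv : ∀ t ∈ I, HasDerivAt (f ∘ γ) 0 t := fun t ht =>
    have ⟨hmem, v, hv, hlie⟩ := hγ t ht
    hf t v hmem hv hlie
  exact hI.is_const_of_deriv_eq_zero hc.isPreconnected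
    (fun t ht => (hderiv t ht).differentiableAt.differentiableWithinAt)
    (fun t ht => (hderiv t ht).deriv) ht h₀

theorem sum_norm_sq_lt {b c : Fin S.g → ℝ} {R : ℝ}
    (hB : ∀ k (ξ : S.d k), ξ ≠ 0 → 0 < ⟪S.Bd k ξ, ξ⟫_ℝ)
    (hb : ∀ k, IsLeast (S.unitValues k) (b k)) (hR : ∑ k, c k / b k < R) {X : ∀ k, S.d k}
    (hX : ∀ k, ⟪S.Bd k (X k), X k⟫_ℝ = c k) : ∑ k, ‖X k‖ ^ 2 < R := by
  refine sum_norm_sq_lt_of_le (fun k => ?_)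
    (fun k (ξ : S.d k) hξ => (hb k).2 ⟨ξ, ξ.2, hξ, rfl⟩) hR hX
  obtain ⟨⟨ξ, hξ, hξ_norm, hbξ⟩, -⟩ := hb k
  exact hbξ ▸ hB k ⟨ξ, hξ⟩ fun h => by
    obtain rfl : ξ = 0 := congrArg Subtype.val h
    simp at hξ_norm

section LevelSet

variable [FiniteDimensional ℝ 𝔤] {c₀ : S.d₀} {c : Fin S.g → ℝ} {c' : ℝ}

theorem F_eq (k : Fin S.g) (x : 𝔤) :
    S.F k x = ⟪S.Bd k ((S.components x).1 k), (S.components x).1 k⟫_ℝ := rfl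

theorem assemble_mem_levelSet_iff {p : (∀ k, S.d k) × S.u} :
    S.assemble c₀ p ∈ S.levelSet c₀ c c' ↔
      p ∈ ellipsoidsInSphere S.Bd c (c' - ‖c₀‖ ^ 2) := by
  simp only [levelSet, ellipsoidsInSphere, Set.mem_ofPred_eq, assemble_mem, true_and, F_eq,
    components_assemble, Submodule.starProjection_apply, orthogonalProjectionOnto_d₀_assemble,
    real_inner_self_eq_norm_sq, norm_sq_assemble, eq_sub_iff_add_eq']

theorem assemble_components_of_mem_levelSet {x : 𝔤} (hx : x ∈ S.levelSet c₀ c c') :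
    S.assemble c₀ (S.components x) = x := by
  rw [← show S.d₀.orthogonalProjectionOnto x = c₀ from Subtype.ext hx.2.1,
    assemble_components hx.1]

theorem levelSet_eq_image :
    S.levelSet c₀ c c' = S.assemble c₀ '' ellipsoidsInSphere S.Bd c (c' - ‖c₀‖ ^ 2) := by
  ext x
  refine ⟨fun hx => ⟨S.components x, ?_, assemble_components_of_mem_levelSet hx⟩, ?_⟩
  · rwa [← assemble_mem_levelSet_iff, assemble_components_of_mem_levelSet hx]
  · rintro ⟨p, hp, rfl⟩
    exact assemble_mem_levelSet_iff.2 hp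

theorem isDiffeoOn_assemble (s : Set ((∀ k, S.d k) × S.u)) :
    IsDiffeoOn (S.assemble c₀) S.components s (S.assemble c₀ '' s) where
  mapsTo := Set.mapsTo_image _ _
  mapsTo_inv := by
    rintro _ ⟨p, hp, rfl⟩
    rwa [components_assemble]
  invOn := ⟨fun p _ => components_assemble c₀ p, by
    rintro _ ⟨p, -, rfl⟩
    rw [components_assemble]⟩
  smooth := smoothOnSubset_of_contDiffAt fun _ _ => (contDiff_assemble c₀).contDiffAt
  smooth_inv := smoothOnSubset_of_contDiffAt fun _ _ => S.components.contDiff.contDiffAt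

theorem diffeomorphicSets_levelSet_sphereProduct
    (hB : ∀ k (ξ : S.d k), ξ ≠ 0 → 0 < ⟪S.Bd k ξ, ξ⟫_ℝ) (hc : ∀ k, 0 < c k)
    (hR : ∀ X : ∀ k, S.d k, (∀ k, ⟪S.Bd k (X k), X k⟫_ℝ = c k) →
      ∑ k, ‖X k‖ ^ 2 < c' - ‖c₀‖ ^ 2) :
    DiffeomorphicSets (S.levelSet c₀ c c')
      (sphereProduct (fun k => Module.finrank ℝ (S.d k)) (Module.finrank ℝ S.u)) :=
  levelSet_eq_image (S := S) ▸ ⟨_, _, ((isDiffeoOn_assemble _).symm.trans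
    (isDiffeoOn_ellipsoidsInSphere hB hc hR)).trans
      (isDiffeoOn_unitSpheres (fun k => (stdOrthonormalBasis ℝ (S.d k)).repr)
        (stdOrthonormalBasis ℝ S.u).repr)⟩

end LevelSet

section Dynamics

variable [FiniteDimensional ℝ 𝔤]

variable (S) in
/-- The vector field `X ↦ [y, B_k X]_{𝔡_k}` that the equations induce on `𝔡_k` when the component
in `𝔲` is `y`. -/
noncomputable def rotationField (k : Fin S.g) : S.u →ₗ[ℝ] S.d k →ₗ[ℝ] S.d k :=
  LinearMap.mk₂ ℝ (fun y X => (S.d k).orthogonalProjectionOnto ⁅(y : 𝔤), S.B X⁆)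
    (fun _ _ _ => by simp) (fun _ _ _ => by simp) (fun _ _ _ => by simp) (fun _ _ _ => by simp)

theorem rotationField_apply (k : Fin S.g) (y : S.u) (X : S.d k) :
    S.rotationField k y X = (S.d k).orthogonalProjectionOnto ⁅(y : 𝔤), S.B X⁆ := rfl

theorem inner_Bd_rotationField (k : Fin S.g) (y : S.u) (X : S.d k) :
    ⟪S.Bd k (S.rotationField k y X), X⟫_ℝ = 0 := by
  rw [S.Bd_isSymmetric k, rotationField_apply,
    Submodule.inner_orthogonalProjectionOnto_eq_of_mem_right]
  exact InvariantInnerLieAlgebra.inner_lie_right_self _ _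

theorem orthogonalProjectionOnto_d₀_lie_assemble (x₀ : S.d₀) (p : (∀ k, S.d k) × S.u) :
    S.d₀.orthogonalProjectionOnto ⁅S.assemble x₀ p, S.A (S.assemble x₀ p)⁆ = 0 := by
  refine ext_inner_left ℝ fun a => ?_
  rw [Submodule.inner_orthogonalProjectionOnto_eq_of_mem_left, inner_lie_assemble (S.d₀_le a.2),
    inner_zero_right]
  exact Finset.sum_eq_zero fun k _ =>
    (S.w₀_orthogonal _).inner_eq a.2.2 (lie_u_mem_w p.2 (S.B_mem_d (p.1 k).2))

theorem orthogonalProjectionOnto_d_lie_assemble (x₀ : S.d₀) (p : (∀ k, S.d k) × S.u)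
    (k : Fin S.g) :
    (S.d k).orthogonalProjectionOnto ⁅S.assemble x₀ p, S.A (S.assemble x₀ p)⁆
      = S.rotationField k p.2 (p.1 k) := by
  refine ext_inner_left ℝ fun a => ?_
  rw [Submodule.inner_orthogonalProjectionOnto_eq_of_mem_left, inner_lie_assemble (S.d_le k a.2),
    rotationField_apply, Submodule.inner_orthogonalProjectionOnto_eq_of_mem_left]
  refine Finset.sum_eq_single_of_mem k (Finset.mem_univ k) fun j _ hj => ?_
  exact (S.w_orthogonal _ _ ((Fin.castLE_injective S.g_le_m).ne hj.symm)).inner_eq a.2.2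
    (lie_u_mem_w p.2 (S.B_mem_d (p.1 j).2))

section Invariance

variable {x v : 𝔤}

theorem orthogonalProjectionOnto_d₀_eq_zero (hx : x ∈ S.𝔡) (hv : v - ⁅x, S.A x⁆ ∈ S.𝔡ᗮ) :
    S.d₀.orthogonalProjectionOnto v = 0 := by
  have h := (mem_orthogonal_𝔡_iff.1 hv).1
  rwa [← assemble_components hx, map_sub, orthogonalProjectionOnto_d₀_lie_assemble, sub_zero] at h

theorem components_fst_eq_rotationField (hx : x ∈ S.𝔡) (hv : v - ⁅x, S.A x⁆ ∈ S.𝔡ᗮ) (k : Fin S.g) :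
    (S.components v).1 k = S.rotationField k (S.components x).2 ((S.components x).1 k) := by
  have h := congrFun (congrArg Prod.fst (mem_orthogonal_𝔡_iff.1 hv).2) k
  rwa [← orthogonalProjectionOnto_d_lie_assemble (S.d₀.orthogonalProjectionOnto x),
    assemble_components hx, ← components_fst, ← sub_eq_zero, ← Pi.sub_apply, ← Prod.fst_sub,
    ← map_sub]

theorem IsSolutionOn.mem_levelSet {γ : ℝ → 𝔤} {I : Set ℝ} {c₀ : 𝔤} {c : Fin S.g → ℝ} {c' : ℝ}
    (hγ : S.IsSolutionOn γ I) (hI : IsOpen I) (hc : I.OrdConnected) {t₀ t : ℝ} (h₀ : t₀ ∈ I)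
    (ht : t ∈ I) (hM : γ t₀ ∈ S.levelSet c₀ c c') : γ t ∈ S.levelSet c₀ c c' := by
  refine ⟨(hγ t ht).1, hM.2.1 ▸ ?_, fun k => hM.2.2.1 k ▸ ?_, hM.2.2.2 ▸ ?_⟩
  · refine hγ.eq_of_hasDerivAt_zero hI hc (f := S.d₀.starProjection) (fun t v hx hv hlie => ?_)
      h₀ ht
    refine (S.d₀.starProjection.hasFDerivAt.comp_hasDerivAt t hv).congr_deriv ?_
    rw [Submodule.starProjection_apply, orthogonalProjectionOnto_d₀_eq_zero hx hlie,
      Submodule.coe_zero]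
  · refine hγ.eq_of_hasDerivAt_zero hI hc (f := S.F k) (fun t v hx hv hlie => ?_) h₀ ht
    have hX := (S.d k).orthogonalProjectionOnto.hasFDerivAt.comp_hasDerivAt t hv
    have hBX := (S.Bd k).toContinuousLinearMap.hasFDerivAt.comp_hasDerivAt t hX
    refine (hBX.inner ℝ hX).congr_deriv ?_
    have hrot := inner_Bd_rotationField k (S.components (γ t)).2 ((S.components (γ t)).1 k)
    rw [← components_fst_eq_rotationField hx hlie, components_fst, components_fst] at hrot
    simp only [Function.comp_apply, LinearMap.coe_toContinuousLinearMap', hrot, add_zero]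
    rw [S.Bd_isSymmetric, real_inner_comm, hrot]
  · refine hγ.eq_of_hasDerivAt_zero hI hc (f := fun x => ⟪x, x⟫_ℝ) (fun t v hx hv hlie => ?_) h₀ ht
    refine (hv.inner ℝ hv).congr_deriv ?_
    rw [real_inner_comm (γ t), inner_eq_zero_of_sub_lie_mem hx hlie, add_zero]

end Invariance

end Dynamics

end EPSData

section TorusPoint

variable {r : ℕ}

theorem torusPoint_mem_stdTorus (φ : Fin r → ℝ) : torusPoint φ ∈ stdTorus r := fun i =>
  Complex.norm_exp_ofReal_mul_I (φ i)

theorem contDiff_torusPoint {n : WithTop ℕ∞} : ContDiff ℝ n (torusPoint (r := r)) :=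
  contDiff_pi.2 fun i => Complex.contDiff_exp.comp
    ((Complex.ofRealCLM.contDiff.comp (contDiff_apply ℝ ℝ i)).mul contDiff_const)

theorem torusPoint_add_single (φ : Fin r → ℝ) (i : Fin r) :
    torusPoint (φ + Pi.single i (2 * Real.pi)) = torusPoint φ := by
  funext j
  rcases eq_or_ne j i with rfl | hij
  · simp [torusPoint, add_mul, Complex.exp_periodic _]
  · simp [torusPoint, hij]

theorem hasDerivAt_torusPoint {φ : ℝ → Fin r → ℝ} {θ : Fin r → ℝ} {t : ℝ} (hφ : HasDerivAt φ θ t)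
    (i : Fin r) : HasDerivAt (fun t => torusPoint (φ t) i)
      (θ i • (Complex.I * torusPoint (φ t) i)) t := by
  refine ((hasDerivAt_pi.1 hφ i).ofReal_comp.mul_const Complex.I).cexp.congr_deriv ?_
  rw [Complex.real_smul, torusPoint]
  ring

end TorusPoint

theorem units_smul_inner {V : Type*} [NormedAddCommGroup V] [InnerProductSpace ℝ V] (σ : ℤˣ)
    (x y : V) : ⟪σ • x, y⟫_ℝ = σ • ⟪x, y⟫_ℝ := by
  rcases Int.units_eq_one_or σ with rfl | rfl <;> simp

theorem existsUnique_units_smul_pos {a : ℝ} (ha : a ≠ 0) : ∃! σ : ℤˣ, 0 < σ • a := by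
  rcases ha.lt_or_gt with ha | ha
  · refine ⟨-1, by simpa using ha, fun σ hσ => ?_⟩
    refine (Int.units_eq_one_or σ).resolve_left ?_
    rintro rfl
    exact ha.not_gt (by simpa using hσ)
  · refine ⟨1, by simpa using ha, fun σ hσ => ?_⟩
    refine (Int.units_eq_one_or σ).resolve_right ?_
    rintro rfl
    exact ha.not_gt (by simpa using hσ)

theorem card_signs {ι : Type*} [Finite ι] {n : ι → ℕ} (hn : ∀ k, n k = 1 ∨ n k = 2) :
    Nat.card (ℤˣ × ({k // n k ≠ 2} → ℤˣ)) = 2 ^ (1 + Nat.card {k // n k = 1}) := by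
  have hiff : ∀ k, n k ≠ 2 ↔ n k = 1 := fun k => by
    have := hn k
    omega
  rw [Nat.card_prod, Nat.card_fun, Nat.card_congr (Equiv.subtypeEquivRight hiff),
    Nat.card_eq_fintype_card (α := ℤˣ), Fintype.card_units_int, pow_add, pow_one]

section TorusFrame

variable {ι : Type*} {V : ι → Type*} [∀ k, NormedAddCommGroup (V k)]
  [∀ k, InnerProductSpace ℝ (V k)] {W : Type*} [NormedAddCommGroup W] [InnerProductSpace ℝ W]
  {T : ∀ k, V k →ₗ[ℝ] V k} {N : ∀ k, W →ₗ[ℝ] V k →ₗ[ℝ] V k} {c : ι → ℝ} {R : ℝ}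

/-- A unit vector `e` spanning the line `W`, and for each of the ellipses `⟪T k x, x⟫ = c k` a pair
of conjugate semi-axes on which `N k e` is the infinitesimal rotation with rate `ν k`. -/
structure TorusFrame (T : ∀ k, V k →ₗ[ℝ] V k) (N : ∀ k, W →ₗ[ℝ] V k →ₗ[ℝ] V k) (c : ι → ℝ) where
  e : W
  norm_e : ‖e‖ = 1
  exists_eq_smul : ∀ y, ∃ a : ℝ, y = a • e
  p : ∀ k, V k
  q : ∀ k, V k
  ν : ι → ℝ
  ellipse : ∀ k, EllipseFrame (T k) (N k e) (c k) (p k) (q k) (ν k)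

theorem nonempty_torusFrame [∀ k, FiniteDimensional ℝ (V k)] (hTs : ∀ k, (T k).IsSymmetric)
    (hT : ∀ k ξ, ξ ≠ 0 → 0 < ⟪T k ξ, ξ⟫_ℝ) (hc : ∀ k, 0 < c k)
    (hN : ∀ k y x, ⟪T k (N k y x), x⟫_ℝ = 0) (hW : Module.finrank ℝ W = 1)
    (hV : ∀ k, Module.finrank ℝ (V k) = 1 ∨ Module.finrank ℝ (V k) = 2) :
    Nonempty (TorusFrame T N c) := by
  have := Module.nontrivial_of_finrank_pos (R := ℝ) (M := W) (by omega)
  obtain ⟨e, he⟩ := exists_norm_eq W zero_le_one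
  have he₀ : e ≠ 0 := norm_ne_zero_iff.1 (he ▸ one_ne_zero)
  have hframe : ∀ k, ∃ p q ν, EllipseFrame (T k) (N k e) (c k) p q ν := fun k =>
    (hV k).elim (exists_ellipseFrame_of_finrank_eq_one (hT k) (hc k) (hN k e))
      (exists_ellipseFrame_of_finrank_eq_two (hTs k) (hT k) (hc k) (hN k e))
  choose p q ν hframe using hframe
  exact ⟨⟨e, he, fun y => (exists_smul_eq_of_finrank_eq_one hW he₀ y).imp fun _ => Eq.symm,
    p, q, ν, hframe⟩⟩

variable {r : ℕ} (idx : {k // Module.finrank ℝ (V k) = 2} ≃ Fin r)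

/-- The phases of the point of the product of the ellipses that has coordinates `z` on the planes:
on a line, where the ellipse is a pair of points, the phase is `1`. -/
noncomputable def phase (z : Fin r → ℂ) (k : ι) : ℂ :=
  if h : Module.finrank ℝ (V k) = 2 then z (idx ⟨k, h⟩) else 1

/-- The rates of change of the phases when the angles move with velocity `θ`. -/
noncomputable def phaseRate (θ : Fin r → ℝ) (k : ι) : ℝ :=
  if h : Module.finrank ℝ (V k) = 2 then θ (idx ⟨k, h⟩) else 0

theorem contDiff_phase {n : WithTop ℕ∞} (k : ι) : ContDiff ℝ n fun z => phase idx z k := by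
  by_cases h : Module.finrank ℝ (V k) = 2
  · simpa only [phase, dif_pos h] using contDiff_apply ℝ ℂ (idx ⟨k, h⟩)
  · simpa only [phase, dif_neg h] using contDiff_const

theorem hasDerivAt_phase {φ : ℝ → Fin r → ℝ} {θ : Fin r → ℝ} {t : ℝ} (hφ : HasDerivAt φ θ t)
    (k : ι) : HasDerivAt (fun t => phase idx (torusPoint (φ t)) k)
      (phaseRate idx θ k • (Complex.I * phase idx (torusPoint (φ t)) k)) t := by
  by_cases h : Module.finrank ℝ (V k) = 2
  · simpa only [phase, phaseRate, dif_pos h] using hasDerivAt_torusPoint hφ (idx ⟨k, h⟩)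
  · simpa only [phase, phaseRate, dif_neg h, zero_smul] using hasDerivAt_const t 1

namespace TorusFrame

variable (F : TorusFrame T N c)

/-- The frame obtained by reversing `e` according to the sign `σ` and the semi-axes `p k` according
to the signs `τ k`. Reversing the `q k` accordingly leaves the rates `ν k` unchanged. -/
def flip (σ : ℤˣ) (τ : ι → ℤˣ) : TorusFrame T N c where
  e := σ • F.e
  norm_e := by rcases Int.units_eq_one_or σ with rfl | rfl <;> simp [F.norm_e]
  exists_eq_smul y := by
    obtain ⟨a, rfl⟩ := F.exists_eq_smul y
    rcases Int.units_eq_one_or σ with rfl | rfl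
    exacts [⟨a, by simp⟩, ⟨-a, by simp⟩]
  p k := τ k • F.p k
  q k := (σ * τ k) • F.q k
  ν := F.ν
  ellipse k := by
    have hN : N k (σ • F.e) = σ • N k F.e := by
      rcases Int.units_eq_one_or σ with rfl | rfl <;> simp
    exact hN ▸ (F.ellipse k).flip σ (τ k)

/-- The point of the product of the ellipses with coordinates `z` on the planes, and equal to `p k`
on the lines. -/
noncomputable def ellipsePoints (z : Fin r → ℂ) (k : ι) : V k :=
  ellipsePoint (F.p k) (F.q k) (phase idx z k)

/-- The coordinates, on those ellipses that lie in planes, of a point of the product of the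
ellipses. -/
noncomputable def ellipseCoords (x : (∀ k, V k) × W) (i : Fin r) : ℂ :=
  ellipseCoord (T (idx.symm i)) (c (idx.symm i)) (F.p (idx.symm i)) (F.q (idx.symm i))
    (x.1 (idx.symm i))

theorem ellipseCoords_apply (x : (∀ k, V k) × W) {k : ι} (hk : Module.finrank ℝ (V k) = 2) :
    F.ellipseCoords idx x (idx ⟨k, hk⟩) = ellipseCoord (T k) (c k) (F.p k) (F.q k) (x.1 k) := by
  rw [ellipseCoords, idx.symm_apply_apply]

theorem contDiff_ellipsePoints {n : WithTop ℕ∞} (k : ι) :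
    ContDiff ℝ n fun z => F.ellipsePoints idx z k :=
  (ellipsePoint _ _).contDiff.comp (contDiff_phase idx k)

theorem hasDerivAt_ellipsePoints {φ : ℝ → Fin r → ℝ} {θ : Fin r → ℝ} {t : ℝ}
    (hφ : HasDerivAt φ θ t) (k : ι) :
    HasDerivAt (fun t => F.ellipsePoints idx (torusPoint (φ t)) k)
      (phaseRate idx θ k • ellipsePoint (F.p k) (F.q k)
        (Complex.I * phase idx (torusPoint (φ t)) k)) t :=
  ((ellipsePoint _ _).hasFDerivAt.comp_hasDerivAt t (hasDerivAt_phase idx hφ k)).congr_deriv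
    (map_smul _ _ _)

theorem ellipsePoints_of_finrank_ne_two {k : ι} (hk : Module.finrank ℝ (V k) ≠ 2) (z : Fin r → ℂ) :
    F.ellipsePoints idx z k = F.p k := by
  rw [ellipsePoints, (F.ellipse k).ellipsePoint_of_finrank_ne_two hk, phase, dif_neg hk,
    Complex.one_re, one_smul]

theorem inner_ellipsePoints {z : Fin r → ℂ} (hz : z ∈ stdTorus r) (k : ι) :
    ⟪T k (F.ellipsePoints idx z k), F.ellipsePoints idx z k⟫_ℝ = c k := by
  by_cases hk : Module.finrank ℝ (V k) = 2
  · rw [ellipsePoints, (F.ellipse k).inner_ellipsePoint_of_finrank_eq_two hk, phase, dif_pos hk,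
      hz, one_pow, mul_one]
  · rw [F.ellipsePoints_of_finrank_ne_two idx hk, (F.ellipse k).inner_left]

theorem phaseRate_smul_eq_iff (hc : ∀ k, c k ≠ 0) {z : Fin r → ℂ} (hz : z ∈ stdTorus r)
    (θ : Fin r → ℝ) (a : ℝ) :
    (∀ k, phaseRate idx θ k • ellipsePoint (F.p k) (F.q k) (Complex.I * phase idx z k)
      = N k (a • F.e) (F.ellipsePoints idx z k)) ↔ θ = fun i => a * F.ν (idx.symm i) := by
  have hN : ∀ k, N k (a • F.e) (F.ellipsePoints idx z k)
      = (a * F.ν k) • ellipsePoint (F.p k) (F.q k) (Complex.I * phase idx z k) := fun k => by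
    rw [map_smul, LinearMap.smul_apply, ellipsePoints, (F.ellipse k).map_ellipsePoint, smul_smul]
  simp only [hN]
  refine ⟨fun h => funext fun i => ?_, ?_⟩
  · obtain ⟨⟨k, hk⟩, rfl⟩ := idx.surjective i
    have hcoord := congrArg (ellipseCoord (T k) (c k) (F.p k) (F.q k)) (h k)
    rw [← map_smul, ← map_smul, (F.ellipse k).ellipseCoord_ellipsePoint (hc k) hk,
      (F.ellipse k).ellipseCoord_ellipsePoint (hc k) hk, phaseRate, dif_pos hk] at hcoord
    have hz₀ : Complex.I * phase idx z k ≠ 0 := by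
      rw [phase, dif_pos hk]
      exact mul_ne_zero Complex.I_ne_zero (norm_ne_zero_iff.1 (by simp [hz _]))
    simpa using smul_left_injective ℝ hz₀ hcoord
  · rintro rfl k
    by_cases hk : Module.finrank ℝ (V k) = 2
    · simp [phaseRate, hk]
    · simp [(F.ellipse k).ellipsePoint_of_finrank_ne_two hk, phase, hk]

variable [Fintype ι]

/-- The square of the radius left for the component in `W` on the sphere of squared radius `R`. -/
noncomputable def radiusSq (R : ℝ) (z : Fin r → ℂ) : ℝ := R - ∑ k, ‖F.ellipsePoints idx z k‖ ^ 2

/-- The parametrization by `stdTorus r` of the component `F.torus R` of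
`ellipsoidsInSphere T c R`. -/
noncomputable def param (R : ℝ) (z : Fin r → ℂ) : (∀ k, V k) × W :=
  (F.ellipsePoints idx z, √(F.radiusSq idx R z) • F.e)

/-- The part of `ellipsoidsInSphere T c R` on the positive side of `e` and, on each line, on the
positive side of `p k`. -/
def torus (R : ℝ) : Set ((∀ k, V k) × W) :=
  {x | x ∈ ellipsoidsInSphere T c R ∧ 0 < ⟪F.e, x.2⟫_ℝ ∧
    ∀ k, Module.finrank ℝ (V k) ≠ 2 → 0 < ⟪T k (F.p k), x.1 k⟫_ℝ}

theorem contDiff_radiusSq {n : WithTop ℕ∞} : ContDiff ℝ n (F.radiusSq idx R) :=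
  contDiff_const.sub (ContDiff.sum fun k _ => (F.contDiff_ellipsePoints idx k).norm_sq ℝ)

theorem contDiffAt_param {n : WithTop ℕ∞} {z : Fin r → ℂ} (hz : F.radiusSq idx R z ≠ 0) :
    ContDiffAt ℝ n (F.param idx R) z :=
  (contDiffAt_pi.2 fun k => (F.contDiff_ellipsePoints idx k).contDiffAt).prodMk
    (((F.contDiff_radiusSq idx).contDiffAt.sqrt hz).smul contDiffAt_const)

theorem exists_hasDerivAt_param {φ : ℝ → Fin r → ℝ} {θ : Fin r → ℝ} {t : ℝ}
    (hφ : HasDerivAt φ θ t) (hρ : F.radiusSq idx R (torusPoint (φ t)) ≠ 0) :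
    ∃ v, HasDerivAt (fun t => F.param idx R (torusPoint (φ t))) v t ∧
      ∀ k, v.1 k = phaseRate idx θ k • ellipsePoint (F.p k) (F.q k)
        (Complex.I * phase idx (torusPoint (φ t)) k) := by
  have hρφ : ContDiff ℝ 1 fun φ => F.radiusSq idx R (torusPoint φ) :=
    (F.contDiff_radiusSq idx).comp contDiff_torusPoint
  have hsqrt : DifferentiableAt ℝ (fun t => √(F.radiusSq idx R (torusPoint (φ t)))) t :=
    ((hρφ.differentiable one_ne_zero _).comp t hφ.differentiableAt).sqrt hρ
  exact ⟨_, (hasDerivAt_pi.2 (F.hasDerivAt_ellipsePoints idx hφ)).prodMk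
    (hsqrt.hasDerivAt.smul_const F.e), fun _ => rfl⟩

theorem contDiff_ellipseCoords [∀ k, FiniteDimensional ℝ (V k)] {n : WithTop ℕ∞} :
    ContDiff ℝ n (F.ellipseCoords idx) := by
  refine contDiff_pi.2 fun i => ?_
  have hx : ContDiff ℝ n fun x : (∀ k, V k) × W => x.1 (idx.symm i) :=
    contDiff_pi.1 contDiff_fst _
  have hcoord : ∀ a, ContDiff ℝ n fun x : (∀ k, V k) × W =>
      ⟪T (idx.symm i) a, x.1 (idx.symm i)⟫_ℝ / c (idx.symm i) := fun a =>
    (contDiff_const.inner ℝ hx).div_const _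
  exact Complex.equivRealProdCLM.symm.contDiff.comp
    ((hcoord (F.p (idx.symm i))).prodMk (hcoord (F.q (idx.symm i))))

theorem radiusSq_pos
    (hR : ∀ X : ∀ k, V k, (∀ k, ⟪T k (X k), X k⟫_ℝ = c k) → ∑ k, ‖X k‖ ^ 2 < R)
    {z : Fin r → ℂ} (hz : z ∈ stdTorus r) : 0 < F.radiusSq idx R z :=
  sub_pos.2 (hR _ (F.inner_ellipsePoints idx hz))

theorem param_mem_torus (hc : ∀ k, 0 < c k)
    (hR : ∀ X : ∀ k, V k, (∀ k, ⟪T k (X k), X k⟫_ℝ = c k) → ∑ k, ‖X k‖ ^ 2 < R)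
    {z : Fin r → ℂ} (hz : z ∈ stdTorus r) :
    F.param idx R z ∈ F.torus R := by
  have hρ := F.radiusSq_pos idx hR hz
  refine ⟨⟨F.inner_ellipsePoints idx hz, ?_⟩, ?_, fun k hk => ?_⟩
  · rw [param, norm_smul, F.norm_e, mul_one, Real.norm_eq_abs, sq_abs, Real.sq_sqrt hρ.le, radiusSq,
      add_sub_cancel]
  · rw [param, inner_smul_right, real_inner_self_eq_norm_sq, F.norm_e, one_pow, mul_one]
    exact Real.sqrt_pos.2 hρ
  · change 0 < ⟪T k (F.p k), F.ellipsePoints idx z k⟫_ℝ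
    rw [F.ellipsePoints_of_finrank_ne_two idx hk, (F.ellipse k).inner_left]
    exact hc k

theorem ellipseCoords_mem_stdTorus (hc : ∀ k, 0 < c k) {x : (∀ k, V k) × W} (hx : x ∈ F.torus R) :
    F.ellipseCoords idx x ∈ stdTorus r := fun i =>
  (F.ellipse _).norm_ellipseCoord (hc _).ne' (idx.symm i).2 (hx.1.1 _)

theorem ellipseCoords_param (hc : ∀ k, 0 < c k) (z : Fin r → ℂ) :
    F.ellipseCoords idx (F.param idx R z) = z := funext fun i => by
  obtain ⟨⟨k, hk⟩, rfl⟩ := idx.surjective i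
  rw [ellipseCoords_apply]
  change ellipseCoord (T k) (c k) (F.p k) (F.q k) (ellipsePoint (F.p k) (F.q k) (phase idx z k)) = _
  rw [(F.ellipse k).ellipseCoord_ellipsePoint (hc k).ne' hk, phase, dif_pos hk]

theorem param_ellipseCoords (hc : ∀ k, 0 < c k) {x : (∀ k, V k) × W} (hx : x ∈ F.torus R) :
    F.param idx R (F.ellipseCoords idx x) = x := by
  have hX : F.ellipsePoints idx (F.ellipseCoords idx x) = x.1 := funext fun k => by
    by_cases hk : Module.finrank ℝ (V k) = 2
    · rw [ellipsePoints, phase, dif_pos hk, ellipseCoords_apply,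
        (F.ellipse k).ellipsePoint_ellipseCoord (hc k).ne']
    · rw [F.ellipsePoints_of_finrank_ne_two idx hk,
        (F.ellipse k).eq_of_finrank_ne_two (hc k) hk (hx.1.1 k) (hx.2.2 k hk)]
  have hy : √(F.radiusSq idx R (F.ellipseCoords idx x)) • F.e = x.2 := by
    obtain ⟨a, ha⟩ := F.exists_eq_smul x.2
    have ha₀ : 0 < a := by
      simpa [ha, inner_smul_right, F.norm_e] using hx.2.1
    rw [radiusSq, hX, ← hx.1.2, add_sub_cancel_left, Real.sqrt_sq (norm_nonneg _), ha, norm_smul,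
      F.norm_e, mul_one, Real.norm_of_nonneg ha₀.le]
  exact Prod.ext hX hy

theorem isDiffeoOn_param [∀ k, FiniteDimensional ℝ (V k)] (hc : ∀ k, 0 < c k)
    (hR : ∀ X : ∀ k, V k, (∀ k, ⟪T k (X k), X k⟫_ℝ = c k) → ∑ k, ‖X k‖ ^ 2 < R) :
    IsDiffeoOn (F.param idx R) (F.ellipseCoords idx) (stdTorus r) (F.torus R) where
  mapsTo _ hz := F.param_mem_torus idx hc hR hz
  mapsTo_inv _ hx := F.ellipseCoords_mem_stdTorus idx hc hx
  invOn := ⟨fun z _ => F.ellipseCoords_param idx hc z, fun _ hx => F.param_ellipseCoords idx hc hx⟩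
  smooth := smoothOnSubset_of_contDiffAt fun _ hz =>
    F.contDiffAt_param idx (F.radiusSq_pos idx hR hz).ne'
  smooth_inv := smoothOnSubset_of_contDiffAt fun _ _ => (F.contDiff_ellipseCoords idx).contDiffAt

theorem mem_torus_flip_iff {σ : ℤˣ} {τ : ι → ℤˣ} {x : (∀ k, V k) × W} :
    x ∈ (F.flip σ τ).torus R ↔ x ∈ ellipsoidsInSphere T c R ∧ 0 < σ • ⟪F.e, x.2⟫_ℝ ∧
      ∀ k, Module.finrank ℝ (V k) ≠ 2 → 0 < τ k • ⟪T k (F.p k), x.1 k⟫_ℝ := by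
  have hT : ∀ k, T k (τ k • F.p k) = τ k • T k (F.p k) := fun k => map_zsmul_unit ..
  simp only [torus, flip, Set.mem_ofPred_eq, units_smul_inner, hT]

theorem inner_e_ne_zero (hR : ∀ X : ∀ k, V k, (∀ k, ⟪T k (X k), X k⟫_ℝ = c k) → ∑ k, ‖X k‖ ^ 2 < R)
    {x : (∀ k, V k) × W} (hx : x ∈ ellipsoidsInSphere T c R) : ⟪F.e, x.2⟫_ℝ ≠ 0 := by
  obtain ⟨a, ha⟩ := F.exists_eq_smul x.2
  have hsphere := hx.2
  intro h
  have ha₀ : a = 0 := by simpa [ha, inner_smul_right, F.norm_e] using h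
  rw [ha, ha₀, zero_smul, norm_zero] at hsphere
  linarith [hR x.1 hx.1]

theorem inner_p_ne_zero (hc : ∀ k, 0 < c k) {x : (∀ k, V k) × W}
    (hx : x ∈ ellipsoidsInSphere T c R) {k : ι} (hk : Module.finrank ℝ (V k) ≠ 2) :
    ⟪T k (F.p k), x.1 k⟫_ℝ ≠ 0 := by
  obtain ⟨a, b, hab⟩ := (F.ellipse k).exists_eq (x.1 k)
  rw [(F.ellipse k).right_eq_zero hk, smul_zero, add_zero] at hab
  have hxk := hx.1 k
  intro h
  have ha₀ : a = 0 := by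
    simpa [hab, inner_smul_right, (F.ellipse k).inner_left, (hc k).ne'] using h
  rw [hab, ha₀, zero_smul, inner_zero_right] at hxk
  exact (hc k).ne hxk

theorem existsUnique_mem_torus (hc : ∀ k, 0 < c k)
    (hR : ∀ X : ∀ k, V k, (∀ k, ⟪T k (X k), X k⟫_ℝ = c k) → ∑ k, ‖X k‖ ^ 2 < R)
    {x : (∀ k, V k) × W} (hx : x ∈ ellipsoidsInSphere T c R) :
    ∃! s : ℤˣ × ({k // Module.finrank ℝ (V k) ≠ 2} → ℤˣ),
      x ∈ (F.flip s.1 (Function.extend Subtype.val s.2 1)).torus R := by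
  obtain ⟨σ, hσ, hσ_unique⟩ := existsUnique_units_smul_pos (F.inner_e_ne_zero hR hx)
  have hτ : ∀ k : {k // Module.finrank ℝ (V k) ≠ 2},
      ∃! τ : ℤˣ, 0 < τ • ⟪T k (F.p k), x.1 k⟫_ℝ := fun k =>
    existsUnique_units_smul_pos (F.inner_p_ne_zero hc hx k.2)
  choose τ hτ hτ_unique using hτ
  have hmem : ∀ s : ℤˣ × ({k // Module.finrank ℝ (V k) ≠ 2} → ℤˣ),
      x ∈ (F.flip s.1 (Function.extend Subtype.val s.2 1)).torus R ↔
        0 < s.1 • ⟪F.e, x.2⟫_ℝ ∧ ∀ k, 0 < s.2 k • ⟪T k (F.p k), x.1 k⟫_ℝ := fun s => by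
    simp only [mem_torus_flip_iff, hx, true_and, Subtype.forall']
    simp only [Subtype.val_injective.extend_apply]
  refine ⟨(σ, τ), (hmem _).2 ⟨hσ, hτ⟩, fun s hs => ?_⟩
  obtain ⟨hs₁, hs₂⟩ := (hmem s).1 hs
  exact Prod.ext (hσ_unique _ hs₁) (funext fun k => hτ_unique k _ (hs₂ k))

end TorusFrame

end TorusFrame

namespace EPSData

variable {𝔤 : Type*} [NormedLieRing 𝔤] [InvariantInnerLieAlgebra 𝔤] [FiniteDimensional ℝ 𝔤]
  {S : EPSData 𝔤} {c₀ : S.d₀} {c : Fin S.g → ℝ} {c' R : ℝ} {r : ℕ}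

-- When `𝔲` is the line through `p.2`, conservation of the norm takes care of the component in `𝔲`.
theorem assemble_sub_lie_mem_orthogonal_iff {p v : (∀ k, S.d k) × S.u}
    (hu : ∀ y : S.u, ∃ a : ℝ, y = a • p.2)
    (hpv : ⟪S.assemble c₀ p, S.assemble 0 v⟫_ℝ = 0) :
    S.assemble 0 v - ⁅S.assemble c₀ p, S.A (S.assemble c₀ p)⁆ ∈ S.𝔡ᗮ ↔
      ∀ k, v.1 k = S.rotationField k p.2 (p.1 k) := by
  set z := S.assemble 0 v - ⁅S.assemble c₀ p, S.A (S.assemble c₀ p)⁆ with hz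
  have hz₀ : S.d₀.orthogonalProjectionOnto z = 0 := by
    rw [hz, map_sub, orthogonalProjectionOnto_d₀_assemble, orthogonalProjectionOnto_d₀_lie_assemble,
      sub_zero]
  have hzd : ∀ k, (S.components z).1 k = v.1 k - S.rotationField k p.2 (p.1 k) := fun k => by
    rw [hz, map_sub, components_assemble, Prod.fst_sub, Pi.sub_apply, components_fst,
      orthogonalProjectionOnto_d_lie_assemble]
  simp only [← sub_eq_zero (a := v.1 _), ← hzd]
  refine ⟨fun h k => by rw [(mem_orthogonal_𝔡_iff.1 h).2]; rfl, fun h => ?_⟩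
  have hpz : ⟪p.2, (S.components z).2⟫_ℝ = 0 := by
    have horth : ⟪S.assemble c₀ p, z⟫_ℝ = 0 := by
      rw [hz, inner_sub_right, hpv, InvariantInnerLieAlgebra.inner_left_self_lie, sub_zero]
    simpa only [assemble, inner_add_left, sum_inner,
      ← Submodule.inner_orthogonalProjectionOnto_eq_of_mem_left, hz₀, ← components_fst,
      ← components_snd, h, inner_zero_right, Finset.sum_const_zero, add_zero] using horth
  obtain ⟨a, ha⟩ := hu (S.components z).2
  have hzu : (S.components z).2 = 0 := by
    rw [← inner_self_eq_zero (𝕜 := ℝ)]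
    nth_rw 1 [ha]
    rw [inner_smul_left, hpz, mul_zero]
  exact mem_orthogonal_𝔡_iff.2 ⟨hz₀, Prod.ext (funext h) hzu⟩

section Torus

variable (F : TorusFrame S.Bd S.rotationField c)
  (idx : {k // Module.finrank ℝ (S.d k) = 2} ≃ Fin r)

theorem isSolutionOn_assemble_param_iff (hc : ∀ k, 0 < c k)
    (hR : ∀ X : ∀ k, S.d k, (∀ k, ⟪S.Bd k (X k), X k⟫_ℝ = c k) → ∑ k, ‖X k‖ ^ 2 < R)
    {φ : ℝ → Fin r → ℝ} {I : Set ℝ} (hI : IsOpen I) (hφ : DifferentiableOn ℝ φ I) :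
    S.IsSolutionOn (fun t => S.assemble c₀ (F.param idx R (torusPoint (φ t)))) I ↔
      ∀ t ∈ I, HasDerivAt φ
        (fun i => √(F.radiusSq idx R (torusPoint (φ t))) * F.ν (idx.symm i)) t := by
  refine forall₂_congr fun t ht => ?_
  have hφt := (hφ.differentiableAt (hI.mem_nhds ht)).hasDerivAt
  have hz := torusPoint_mem_stdTorus (φ t)
  have hρ := F.radiusSq_pos idx hR hz
  obtain ⟨v, hv, hv_fst⟩ := F.exists_hasDerivAt_param idx hφt hρ.ne'
  have hx := hasDerivAt_assemble c₀ hv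
  have horth : ⟪S.assemble c₀ (F.param idx R (torusPoint (φ t))), S.assemble 0 v⟫_ℝ = 0 := by
    have hnorm : ∀ t, ‖S.assemble c₀ (F.param idx R (torusPoint (φ t)))‖ ^ 2 = ‖c₀‖ ^ 2 + R :=
      fun t => by
        rw [norm_sq_assemble, (F.param_mem_torus idx hc hR (torusPoint_mem_stdTorus (φ t))).1.2]
    simpa using hx.norm_sq.unique ((hasDerivAt_const t (‖c₀‖ ^ 2 + R)).congr_of_eventuallyEq
      (.of_forall hnorm))
  have hspan : ∀ y : S.u, ∃ a : ℝ, y = a • (F.param idx R (torusPoint (φ t))).2 := fun y => by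
    obtain ⟨a, rfl⟩ := F.exists_eq_smul y
    refine ⟨a / √(F.radiusSq idx R (torusPoint (φ t))), ?_⟩
    rw [TorusFrame.param, smul_smul, div_mul_cancel₀ _ (Real.sqrt_pos.2 hρ).ne']
  have hvel := (assemble_sub_lie_mem_orthogonal_iff hspan horth).trans <| by
    simp only [hv_fst]
    exact F.phaseRate_smul_eq_iff idx (fun k => (hc k).ne') hz (deriv φ t) _
  constructor
  · rintro ⟨-, v', hx', hlie⟩
    rw [hx'.unique hx, hvel] at hlie
    exact hlie ▸ hφt
  · exact fun h => ⟨assemble_mem _ _, _, hx, hvel.2 (hφt.unique h)⟩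

variable (c₀) in
theorem exists_angular_coordinates (hc : ∀ k, 0 < c k)
    (hR : ∀ X : ∀ k, S.d k, (∀ k, ⟪S.Bd k (X k), X k⟫_ℝ = c k) → ∑ k, ‖X k‖ ^ 2 < R) :
    ∃ (f : (Fin r → ℂ) → 𝔤) (f' : 𝔤 → (Fin r → ℂ)) (Φ : (Fin r → ℝ) → ℝ),
      IsDiffeoOn f f' (stdTorus r) (S.assemble c₀ '' F.torus R) ∧
      ContDiff ℝ ∞ Φ ∧ (∀ φ, 0 < Φ φ) ∧
      (∀ φ (i : Fin r), Φ (φ + Pi.single i (2 * Real.pi)) = Φ φ) ∧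
      ∀ (I : Set ℝ) (φ : ℝ → Fin r → ℝ), IsOpen I → DifferentiableOn ℝ φ I →
        (S.IsSolutionOn (fun t => f (torusPoint (φ t))) I ↔
          ∀ t ∈ I, HasDerivAt φ (fun i => F.ν (idx.symm i) / Φ (φ t)) t) := by
  have hρ : ∀ φ, 0 < √(F.radiusSq idx R (torusPoint φ)) := fun φ =>
    Real.sqrt_pos.2 (F.radiusSq_pos idx hR (torusPoint_mem_stdTorus φ))
  refine ⟨_, _, fun φ => (√(F.radiusSq idx R (torusPoint φ)))⁻¹,
    (F.isDiffeoOn_param idx hc hR).trans (isDiffeoOn_assemble _), ?_, fun φ => inv_pos.2 (hρ φ),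
    fun φ i => by simp only [torusPoint_add_single], fun I φ hI hφ => ?_⟩
  · exact (((F.contDiff_radiusSq idx).comp contDiff_torusPoint).sqrt fun φ =>
      (Real.sqrt_pos.1 (hρ φ)).ne').inv fun φ => (hρ φ).ne'
  · simp only [div_inv_eq_mul, mul_comm (F.ν _)]
    exact isSolutionOn_assemble_param_iff F idx hc hR hI hφ

end Torus

theorem isUnionOfTori_levelSet
    (hB : ∀ k (ξ : S.d k), ξ ≠ 0 → 0 < ⟪S.Bd k ξ, ξ⟫_ℝ) (hc : ∀ k, 0 < c k)
    (hR : ∀ X : ∀ k, S.d k, (∀ k, ⟪S.Bd k (X k), X k⟫_ℝ = c k) →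
      ∑ k, ‖X k‖ ^ 2 < c' - ‖c₀‖ ^ 2)
    (hd : ∀ k, Module.finrank ℝ (S.d k) = 1 ∨ Module.finrank ℝ (S.d k) = 2)
    (hu : Module.finrank ℝ S.u = 1) :
    S.IsUnionOfTori (S.levelSet c₀ c c')
      (2 ^ (1 + Nat.card {k // Module.finrank ℝ (S.d k) = 1}))
      (Nat.card {k // Module.finrank ℝ (S.d k) = 2}) := by
  obtain ⟨F⟩ := nonempty_torusFrame (T := S.Bd) (N := S.rotationField) S.Bd_isSymmetric hB hc
    inner_Bd_rotationField hu hd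
  let idx := Finite.equivFin {k // Module.finrank ℝ (S.d k) = 2}
  let signs := (Finite.equivFinOfCardEq (card_signs hd)).symm
  let F' := fun s : ℤˣ × ({k // Module.finrank ℝ (S.d k) ≠ 2} → ℤˣ) =>
    F.flip s.1 (Function.extend Subtype.val s.2 1)
  have huniq : ∀ p ∈ ellipsoidsInSphere S.Bd c (c' - ‖c₀‖ ^ 2),
      ∃! j, p ∈ (F' (signs j)).torus (c' - ‖c₀‖ ^ 2) := fun p hp =>
    (signs.bijective.existsUnique_iff (p := fun s => p ∈ (F' s).torus _)).1
      (F.existsUnique_mem_torus hc hR hp)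
  refine ⟨fun j => S.assemble c₀ '' (F' (signs j)).torus (c' - ‖c₀‖ ^ 2), fun i => F.ν (idx.symm i),
    ?_, fun i j hij => ?_, fun j => ?_⟩
  · rw [levelSet_eq_image, ← Set.image_iUnion]
    congr 1
    ext p
    simp only [Set.mem_iUnion]
    exact ⟨fun hp => (huniq p hp).exists, fun ⟨j, hp⟩ => hp.1⟩
  · have hinj : (S.assemble c₀).Injective := 
      Function.LeftInverse.injective fun p => components_assemble c₀ p
    refine (Set.disjoint_image_iff hinj).2 (Set.disjoint_left.2 fun p hi hj => hij ?_)
    exact (huniq p hi.1).unique hi hj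
  · exact exists_angular_coordinates c₀ (F' (signs j)) idx hc hR

theorem finrank_d_pos (k : Fin S.g) : 0 < Module.finrank ℝ (S.d k) :=
  Submodule.one_le_finrank_iff.2 (S.𝔡_inf_w_ne_bot k)

end EPSData

theorem mainTheorem8 {𝔤 : Type*} [NormedLieRing 𝔤] [InvariantInnerLieAlgebra 𝔤]
    [FiniteDimensional ℝ 𝔤] (S : EPSData 𝔤)
    (c₀ : 𝔤) (hc₀ : c₀ ∈ S.d₀) (c : Fin S.g → ℝ) (c' : ℝ) :
    -- the level set is invariant
    (∀ (I : Set ℝ) (x : ℝ → 𝔤), IsOpen I → I.OrdConnected → S.IsSolutionOn x I →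
      ∀ t₀ ∈ I, x t₀ ∈ S.levelSet c₀ c c' → ∀ t ∈ I, x t ∈ S.levelSet c₀ c c') ∧
    ((∀ k, S.BPosDef k) → (∀ k, 0 < c k) →
      ∀ b : Fin S.g → ℝ, (∀ k, IsLeast (S.unitValues k) (b k)) →
      ‖c₀‖ ^ 2 + ∑ k, c k / b k < c' →
      -- part 1
      DiffeomorphicSets (S.levelSet c₀ c c')
        (sphereProduct (fun k => Module.finrank ℝ (S.d k)) (Module.finrank ℝ S.u)) ∧
      -- part 2, all the spaces of dimension two
      ((∀ k, Module.finrank ℝ (S.d k) = 2) → Module.finrank ℝ S.u = 1 →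
        S.IsUnionOfTori (S.levelSet c₀ c c') 2 S.g) ∧
      -- part 2, with one-dimensional spaces allowed
      ((∀ k, Module.finrank ℝ (S.d k) ≤ 2) → Module.finrank ℝ S.u = 1 →
        S.IsUnionOfTori (S.levelSet c₀ c c')
          (2 ^ (1 + Nat.card {k : Fin S.g // Module.finrank ℝ (S.d k) = 1}))
          (Nat.card {k : Fin S.g // Module.finrank ℝ (S.d k) = 2}))) := by
  lift c₀ to S.d₀ using hc₀
  refine ⟨fun I x hI hc hx t₀ h₀ hM t ht => hx.mem_levelSet hI hc h₀ ht hM,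
    fun hB hc b hb hc' => ?_⟩
  have hBd : ∀ k (ξ : S.d k), ξ ≠ 0 → 0 < inner ℝ (S.Bd k ξ) ξ := fun k ξ hξ =>
    hB k ξ ξ.2 (by simpa using hξ)
  have hR : ∀ X : ∀ k, S.d k, (∀ k, inner ℝ (S.Bd k (X k)) (X k) = c k) →
      ∑ k, ‖X k‖ ^ 2 < c' - ‖c₀‖ ^ 2 := fun X =>
    EPSData.sum_norm_sq_lt hBd hb (lt_sub_iff_add_lt'.2 hc')
  refine ⟨EPSData.diffeomorphicSets_levelSet_sphereProduct hBd hc hR, fun hd hu => ?_,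
    fun hd hu => ?_⟩
  · simpa [hd] using EPSData.isUnionOfTori_levelSet hBd hc hR (fun k => .inr (hd k)) hu
  · refine EPSData.isUnionOfTori_levelSet hBd hc hR (fun k => ?_) hu
    have := S.finrank_d_pos k
    have := hd k
    omega
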